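/- Let $Q$ be a smooth Hausdorff manifold of dimension $n>2$ with a smooth metric of arbitrary signature, whose contravariant form is $\mathbf G=(g^{ij})$. Let $(\mathbf K_1,\dots,\mathbf K_n=\mathbf G)$ be a basis of a conformal Killing space (CK-space) on $Q$: the $\mathbf K_a$ are smooth symmetric contravariant two-tensors that are linearly independent at every point; each is a conformal Killing tensor, i.e. $[\mathbf K_a,\mathbf G]=2\,\mathbf C_a\odot\mathbf G$ for some vector field $\mathbf C_a$; they are in conformal involution, i.e. $[\mathbf K_a,\mathbf K_b]=\mathbf C_{ab}\odot\mathbf G$ for some vector fields $\mathbf C_{ab}$ (here $[\cdot,\cdot]$ is the Lie–Schouten bracket and $\odot$ the symmetric product); and there is a smooth frame $(\mathbf E_1,\dots,\mathbf E_n)$ of common eigenvectors. Let $\lambda_a^b$ be the (real) eigenvalue of $\mathbf K_a$, with respect to $\mathbf G$, belonging to $\mathbf E_b$. Let $\Lambda=(\lambda_a^b)$ (row index $a$, column index $b$), let $\Lambda_j^i$ be $\Lambda$ without its $j$-th row and $i$-th column, and put $$f_i^{jh}=(-1)^{j+h}\,\frac{\det\Lambda_j^i}{\det\Lambda_h^i}\qquad\text{on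 the open set where }\det\Lambda_h^i\neq 0 .$$ A vector field $\mathbf X$ is a conformal Killing vector (CKV) if it is smooth and $\mathcal L_{\mathbf X}\mathbf G=F\,\mathbf G$ for some function $F$. Then for every $i=1,\dots,n$ one and only one of the following statements holds. I) $\mathbf E_i$ is a CKV up to a scalar factor: there is a smooth nowhere vanishing function $\rho$ on $Q$ such that $\rho\,\mathbf E_i$ is a CKV. II) There are indices $h<j<n$ such that $df_i^{jh}\ne0$ at some point of the domain of $f_i^{jh}$, and every such point has an open neighbourhood, contained in this domain, in which each equation $f_i^{jh}=\mathrm{const}$ defines an embedded hypersurface (possibly empty) orthogonal to $\mathbf E_i$. -/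

import Mathlib

open scoped Manifold ContDiff

noncomputable section

namespace CKSpace

section Tensors

variable {d : ℕ} {M : Type*} [TopologicalSpace M] [ChartedSpace (EuclideanSpace ℝ (Fin d)) M]
  [IsManifold (𝓡 d) ∞ M]

/-- Real-valued smooth (that is, `C^∞`) functions on a `d`-dimensional manifold. -/
def IsSmooth (f : M → ℝ) : Prop := ContMDiff (𝓡 d) 𝓘(ℝ, ℝ) ∞ f

/-- The differential of a function at a point, as a covector. -/
abbrev diff (f : M → ℝ) (x : M) : TangentSpace (𝓡 d) x →L[ℝ] ℝ := mvfderiv (𝓡 d) f x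

/-- Smooth vector fields, as sections of the tangent bundle. -/
def IsSmoothField (X : (x : M) → TangentSpace (𝓡 d) x) : Prop :=
  ContMDiff (𝓡 d) (𝓡 d).tangent ∞ (fun x => (⟨x, X x⟩ : TangentBundle (𝓡 d) M))

variable (d M) in
/-- Smooth symmetric contravariant two-tensors `K = (K^{ij})`: at every point a symmetric bilinear
form on the cotangent space. Smoothness says that the functions `K(df, dh)` are smooth for all
smooth `f` and `h`; on a Hausdorff manifold, where coordinate functions can be cut off, this means
exactly that the components `K^{ij} = K(dx^i, dx^j)` are smooth in every chart. -/
structure SymTensor where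
  /-- The bilinear form on the cotangent space at `x`. -/
  form : (x : M) → LinearMap.BilinForm ℝ (TangentSpace (𝓡 d) x →L[ℝ] ℝ)
  symm : ∀ x α β, form x α β = form x β α
  smooth : ∀ f h : M → ℝ, IsSmooth (d := d) f → IsSmooth (d := d) h →
    IsSmooth (d := d) (fun x => form x (diff f x) (diff h x))

variable (d M) in
/-- A metric of arbitrary signature, given by its contravariant form `G = (g^{ij})`. -/
structure Metric extends SymTensor d M where
  nondegenerate : ∀ x (α : TangentSpace (𝓡 d) x →L[ℝ] ℝ), (∀ β, form x α β = 0) → α = 0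

/-- The function `K(df, df)`. -/
def SymTensor.quad (K : SymTensor d M) (f : M → ℝ) (x : M) : ℝ :=
  K.form x (diff f x) (diff f x)

/-- The Lie-Schouten bracket `[K, L]` of two symmetric contravariant two-tensors is the symmetric
contravariant three-tensor whose cubic polynomial on the cotangent bundle is the Poisson bracket
`∂P_K/∂p · ∂P_L/∂q - ∂P_K/∂q · ∂P_L/∂p` of the quadratic polynomials `P_K(q, p) = K^{ij} p_i p_j`
and `P_L`. Here is its value on the covector `p = df`, that is
`2 (K^{il} ∂_i L^{jk} - L^{il} ∂_i K^{jk}) ∂_j f ∂_k f ∂_l f`: in the formula below the terms with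
second derivatives of `f` cancel. As every covector at a point is the differential of a smooth
function, these values determine the bracket. -/
def schouten (K L : SymTensor d M) (f : M → ℝ) (x : M) : ℝ :=
  2 * (K.form x (diff f x) (diff (L.quad f) x) - L.form x (diff f x) (diff (K.quad f) x))

/-- The symmetric product `C ⊙ G` of a vector field and a two-tensor, evaluated on `(df, df, df)`. -/
def symProd (C : (x : M) → TangentSpace (𝓡 d) x) (G : SymTensor d M) (f : M → ℝ) (x : M) : ℝ :=
  diff f x (C x) * G.quad f x

/-- `[K, L] = C ⊙ G` for some vector field `C` (which is then smooth automatically). -/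
def InConformalInvolution (G K L : SymTensor d M) : Prop :=
  ∃ C : (x : M) → TangentSpace (𝓡 d) x, ∀ f : M → ℝ, IsSmooth (d := d) f →
    ∀ x, schouten K L f x = symProd C G f x

/-- Conformal Killing tensors: `[K, G] = 2 C ⊙ G` for some vector field `C`. -/
def IsCKT (G K : SymTensor d M) : Prop :=
  ∃ C : (x : M) → TangentSpace (𝓡 d) x, ∀ f : M → ℝ, IsSmooth (d := d) f →
    ∀ x, schouten K G f x = 2 * symProd C G f x

/-- The Lie derivative `L_X G` of a symmetric contravariant two-tensor along a vector field,
evaluated on `(df, df)`: `X (G(df, df)) - 2 G(df, d(X f))`, by the Leibniz rule. -/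
def lieDeriv (X : (x : M) → TangentSpace (𝓡 d) x) (G : SymTensor d M) (f : M → ℝ) (x : M) : ℝ :=
  diff (G.quad f) x (X x) - 2 * G.form x (diff f x) (diff (fun y => diff f y (X y)) x)

/-- Conformal Killing vectors: smooth vector fields with `L_X G = F G` for some function `F`
(which is then smooth automatically). -/
def IsCKV (G : SymTensor d M) (X : (x : M) → TangentSpace (𝓡 d) x) : Prop :=
  IsSmoothField X ∧ ∃ F : M → ℝ, ∀ f : M → ℝ, IsSmooth (d := d) f →
    ∀ x, lieDeriv X G f x = F x * G.quad f x

/-- `θ` is the covector obtained from the vector `v` by lowering the index with the metric. -/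
def IsLowered (G : SymTensor d M) (x : M) (v : TangentSpace (𝓡 d) x)
    (θ : TangentSpace (𝓡 d) x →L[ℝ] ℝ) : Prop :=
  ∀ β : TangentSpace (𝓡 d) x →L[ℝ] ℝ, G.form x θ β = β v

/-- Orthogonality of two tangent vectors. -/
def Orthogonal (G : SymTensor d M) (x : M) (v w : TangentSpace (𝓡 d) x) : Prop :=
  ∃ θ, IsLowered G x w θ ∧ θ v = 0

/-- `v` is an eigenvector of `K` with respect to the metric, with real eigenvalue `μ`:
`K^{ij} g_{jk} v^k = μ v^i`. -/
def IsEigenvector (G K : SymTensor d M) (x : M) (v : TangentSpace (𝓡 d) x) (μ : ℝ) : Prop :=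
  v ≠ 0 ∧ ∃ θ, IsLowered G x v θ ∧ ∀ β, K.form x θ β = μ * β v

/-- `S` is an embedded hypersurface (locally a slice `φ^k = const` of a smooth chart `φ`) all of
whose tangent spaces are orthogonal to the vector field `X`. -/
def IsOrthogonalHypersurface (G : SymTensor d M) (X : (x : M) → TangentSpace (𝓡 d) x)
    (S : Set M) : Prop :=
  ∀ x ∈ S, ∃ φ ∈ IsManifold.maximalAtlas (𝓡 d) ∞ M, ∃ k : Fin d, x ∈ φ.source ∧
    S ∩ φ.source = {y ∈ φ.source | φ y k = φ x k} ∧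
    ∀ v : TangentSpace (𝓡 d) x, diff (fun y => φ y k) x v = 0 → Orthogonal G x v (X x)

end Tensors

section Basis

/-- A basis `(K_1, …, K_N = G)` of a conformal Killing space, on a manifold of dimension
`N = n + 1`, with its common eigenvectors `E_i` and their eigenvalues `λ_a^i`: pointwise independent
conformal Killing tensors, in conformal involution, with a frame of common eigenvectors. -/
structure CKBasis {n : ℕ} {M : Type*} [TopologicalSpace M]
    [ChartedSpace (EuclideanSpace ℝ (Fin (n + 1))) M] [IsManifold (𝓡 (n + 1)) ∞ M]
    (G : Metric (n + 1) M) where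
  K : Fin (n + 1) → SymTensor (n + 1) M
  K_last : K (Fin.last n) = G.toSymTensor
  isCKT : ∀ a, IsCKT G.toSymTensor (K a)
  involution : ∀ a b, InConformalInvolution G.toSymTensor (K a) (K b)
  /-- Pointwise linear independence of the tensors, regarded as functions of two covectors. -/
  independent : ∀ x, LinearIndependent ℝ
    (fun a (p : (TangentSpace (𝓡 (n + 1)) x →L[ℝ] ℝ) × (TangentSpace (𝓡 (n + 1)) x →L[ℝ] ℝ)) =>
      (K a).form x p.1 p.2)
  E : Fin (n + 1) → (x : M) → TangentSpace (𝓡 (n + 1)) x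
  smooth_E : ∀ i, IsSmoothField (E i)
  frame : ∀ x, LinearIndependent ℝ (fun i => E i x)
  /-- `eigenvalue a i` is the eigenvalue of `K a` belonging to `E i`. -/
  eigenvalue : Fin (n + 1) → Fin (n + 1) → M → ℝ
  eigen : ∀ a i x, IsEigenvector G.toSymTensor (K a) x (E i x) (eigenvalue a i x)

variable {n : ℕ} {M : Type*} [TopologicalSpace M]
  [ChartedSpace (EuclideanSpace ℝ (Fin (n + 1))) M] [IsManifold (𝓡 (n + 1)) ∞ M]
  {G : Metric (n + 1) M}

/-- The matrix of the eigenvalues; the rows belong to the tensors, the columns to the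
eigenvectors. -/
def CKBasis.Lam (B : CKBasis G) (x : M) : Matrix (Fin (n + 1)) (Fin (n + 1)) ℝ :=
  Matrix.of fun a i => B.eigenvalue a i x

/-- `det Λ_j^i`: the minor of `Λ` without the `j`-th row and the `i`-th column. -/
def CKBasis.minor (B : CKBasis G) (i j : Fin (n + 1)) (x : M) : ℝ :=
  ((B.Lam x).submatrix j.succAbove i.succAbove).det

/-- The open set on which the fundamental function `f_i^{jh}` is defined (whatever `j`). -/
def CKBasis.dom (B : CKBasis G) (i h : Fin (n + 1)) : Set M := {x | B.minor i h x ≠ 0}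

/-- The fundamental function `f_i^{jh} = (-1)^{j+h} det Λ_j^i / det Λ_h^i`, to be considered
on `B.dom i h` only. -/
def CKBasis.fund (B : CKBasis G) (i j h : Fin (n + 1)) (x : M) : ℝ :=
  (-1) ^ ((j : ℕ) + (h : ℕ)) * (B.minor i j x / B.minor i h x)

/-- `E_i` is a conformal Killing vector up to a scalar factor. -/
def CKBasis.IsConformalSymmetry (B : CKBasis G) (i : Fin (n + 1)) : Prop :=
  ∃ ρ : M → ℝ, IsSmooth (d := n + 1) ρ ∧ (∀ x, ρ x ≠ 0) ∧
    IsCKV G.toSymTensor (fun x => ρ x • B.E i x)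

/-- For some indices `h < j < N`, the function `f_i^{jh}` has a nonzero differential somewhere on
its domain, and near every such point its level sets are hypersurfaces orthogonal to `E_i`. -/
def CKBasis.FundDefinesHypersurfaces (B : CKBasis G) (i : Fin (n + 1)) : Prop :=
  ∃ h j : Fin (n + 1), h < j ∧ j < Fin.last n ∧
    (∃ p ∈ B.dom i h, diff (d := n + 1) (B.fund i j h) p ≠ 0) ∧
    ∀ p ∈ B.dom i h, diff (d := n + 1) (B.fund i j h) p ≠ 0 →
      ∃ V : Set M, IsOpen V ∧ p ∈ V ∧ V ⊆ B.dom i h ∧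
        ∀ c : ℝ, IsOrthogonalHypersurface G.toSymTensor (B.E i) {x ∈ V | B.fund i j h x = c}

end Basis

end CKSpace

end

/-! Fix `i` and `h`. Up to the common factor `1 / adjugate i h`, the numbers `f_i^{ah}` form the
`i`-th row of the adjugate of `Λ`, so this row annihilates every column of `Λ` except the `i`-th.
Hence `∑ a, f_i^{ah} K_a` is diagonal with a single entry: it is a multiple of `E_i ⊗ E_i`.

In the frame of eigenvectors the conformal Killing equation says `E_k(λ_a^l - λ_a^k) = Γ_{kl} (λ_a^k
- λ_a^l)` for `k ≠ l`, with `Γ_{kl}` independent of `a` (`deriv_eigenvalue_sub`). Contract it with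
`f_i^{ah}`. For `k, l ≠ i` the right side disappears, so `∑ a, f_i^{ah} E_k(λ_a^l)` does not depend
on `l ≠ i`. Differentiating `∑ a, f_i^{ah} λ_a^l = 0` then gives `E_k(f_i^{jh}) = 0` for all `j`
other than the last: the eigenvalues of `G` are 1, so only the last entry can absorb the common
value (`diff_fund_apply_of_ne`). Thus `df_i^{jh}` is proportional to `E_i` with lowered index, and
where it is nonzero the level sets are hypersurfaces orthogonal to `E_i`.

The alternatives exclude each other: if `ρ E_i` is a CKV, then `Γ_{il}` is the same for all `l ≠ i`,
and the contraction also gives `E_i(f_i^{jh}) = 0`. One of them must hold: if all differentials with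
`h < j` vanish, so do those with `h ≥ j`, and the `f_i^{jh}` are locally constant. A linear
combination of the `K_a` with constant coefficients then equals `± X ⊗ X`, up to a positive constant
and a multiple of `G`, where `X` is a rescaled `E_i`. Its conformal Killing equation makes `X ⊙ L_X
G` a multiple of `G`, and this forces `L_X G = F G`. -/

noncomputable section

namespace CKSpace

open Filter Topology

/-! ### Functions with nonzero differential as coordinates -/

section Straightening

variable {d : ℕ}

/-- A smooth function with nonzero differential can be used as a coordinate. -/
theorem exists_openPartialHomeomorph_coord {F : EuclideanSpace ℝ (Fin d) → ℝ}
    {U : Set (EuclideanSpace ℝ (Fin d))} (hU : IsOpen U) (hF : ContDiffOn ℝ ∞ F U)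
    {a : EuclideanSpace ℝ (Fin d)} (ha : a ∈ U) (hd : fderiv ℝ F a ≠ 0) :
    ∃ Φ : OpenPartialHomeomorph (EuclideanSpace ℝ (Fin d)) (EuclideanSpace ℝ (Fin d)), ∃ k : Fin d,
      a ∈ Φ.source ∧ Φ.source ⊆ U ∧ ContDiffOn ℝ ∞ Φ Φ.source ∧ ContDiffOn ℝ ∞ Φ.symm Φ.target ∧
      ∀ u ∈ Φ.source, Φ u k = F u ∧ fderiv ℝ F u ≠ 0 := by
  obtain ⟨k, hk⟩ : ∃ k, fderiv ℝ F a (EuclideanSpace.single k 1) ≠ 0 := by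
    by_contra! h
    refine hd (ContinuousLinearMap.coe_injective ?_)
    refine (EuclideanSpace.basisFun (Fin d) ℝ).toBasis.ext fun k => ?_
    simpa using h k
  set e : EuclideanSpace ℝ (Fin d) := EuclideanSpace.single k 1 with he
  let P : EuclideanSpace ℝ (Fin d) →L[ℝ] ℝ := EuclideanSpace.proj k
  -- Replaces the `k`-th coordinate by `F`. The derivative is injective as soon as `∂_k F ≠ 0`.
  let Φ₀ : EuclideanSpace ℝ (Fin d) → EuclideanSpace ℝ (Fin d) := fun u => u + (F u - P u) • e
  have hPe : P e = 1 := by simp [P, he]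
  have hΦ₀ : ContDiffOn ℝ ∞ Φ₀ U :=
    contDiffOn_id.add ((hF.sub P.contDiff.contDiffOn).smul contDiffOn_const)
  let L : (EuclideanSpace ℝ (Fin d) →L[ℝ] ℝ) →
      (EuclideanSpace ℝ (Fin d) →L[ℝ] EuclideanSpace ℝ (Fin d)) :=
    fun α => ContinuousLinearMap.id ℝ _ + (α - P).smulRight e
  have hFd : ∀ u ∈ U, HasFDerivAt F (fderiv ℝ F u) u := fun u hu =>
    ((hF.contDiffAt (hU.mem_nhds hu)).differentiableAt (by simp)).hasFDerivAt
  have hL : ∀ u ∈ U, HasFDerivAt Φ₀ (L (fderiv ℝ F u)) u := fun u hu =>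
    (hasFDerivAt_id u).add (((hFd u hu).sub P.hasFDerivAt).smul_const e)
  have hinj : ∀ α : EuclideanSpace ℝ (Fin d) →L[ℝ] ℝ, α e ≠ 0 →
      Function.Injective (L α).toLinearMap := by
    intro α hα
    refine (injective_iff_map_eq_zero _).2 fun v hv => ?_
    have hv' : v + (α v - P v) • e = 0 := hv
    have h1 : α v = 0 := by
      have := congrArg P hv'
      simpa [hPe] using this
    have h2 : v = P v • e := by
      rw [h1] at hv'
      have := eq_neg_of_add_eq_zero_left hv'
      rw [this]; simp [hPe]
    rw [h2, map_smul, smul_eq_mul] at h1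
    rcases mul_eq_zero.1 h1 with h | h
    · rw [h2, h, zero_smul]
    · exact absurd h hα
  have hequiv : ∀ α : EuclideanSpace ℝ (Fin d) →L[ℝ] ℝ, α e ≠ 0 →
      ∃ A : EuclideanSpace ℝ (Fin d) ≃L[ℝ] EuclideanSpace ℝ (Fin d), (A : _ →L[ℝ] _) = L α :=
    fun α hα => ⟨(LinearEquiv.ofInjectiveEndo _ (hinj α hα)).toContinuousLinearEquiv, by
      ext v; rfl⟩
  -- Restricting to `∂_k F ≠ 0` makes the inverse smooth on the whole target, not only at the image
  -- of `a`, and keeps the differential of `F` nonzero on the source.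
  let U' : Set (EuclideanSpace ℝ (Fin d)) := U ∩ (fun u => fderiv ℝ F u e) ⁻¹' {0}ᶜ
  have hU' : IsOpen U' := by
    refine ContinuousOn.isOpen_inter_preimage ?_ hU isOpen_compl_singleton
    exact (hF.continuousOn_fderiv_of_isOpen hU (by simp)).clm_apply continuousOn_const
  obtain ⟨A, hA⟩ := hequiv _ hk
  have hcd := hΦ₀.contDiffAt (hU.mem_nhds ha)
  have hfd : HasFDerivAt Φ₀ (A : _ →L[ℝ] _) a := hA ▸ hL a ha
  let Φ := (hcd.toOpenPartialHomeomorph Φ₀ hfd (by simp)).restrOpen U' hU'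
  have hsrc : Φ.source ⊆ U' := fun u hu => hu.2
  refine ⟨Φ, k, ⟨hcd.mem_toOpenPartialHomeomorph_source hfd (by simp), ha, hk⟩,
    hsrc.trans Set.inter_subset_left, hΦ₀.mono (hsrc.trans Set.inter_subset_left), ?_, ?_⟩
  · intro v hv
    have hu := hsrc (Φ.map_target hv)
    obtain ⟨A', hA'⟩ := hequiv _ hu.2
    exact (Φ.contDiffAt_symm hv (hA' ▸ hL _ hu.1)
      (hΦ₀.contDiffAt (hU.mem_nhds hu.1))).contDiffWithinAt
  · intro u hu
    have : P (Φ₀ u) = F u := by simp [Φ₀, hPe]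
    exact ⟨this, fun h => (hsrc hu).2 (by simp [h])⟩

end Straightening

/-! ### Differentials of functions on the manifold -/

section Calculus

variable {d : ℕ} {M : Type*} [TopologicalSpace M] [ChartedSpace (EuclideanSpace ℝ (Fin d)) M]

theorem diff_congr {f g : M → ℝ} {x : M} (h : f =ᶠ[𝓝 x] g) :
    diff (d := d) f x = diff g x := by
  simp only [diff, mvfderiv, h.mfderiv_eq]
  ext v
  simp
  rfl

theorem diff_const (c : ℝ) (x : M) : diff (d := d) (fun _ : M => c) x = 0 := mvfderiv_const c

theorem diff_add {f g : M → ℝ} {x : M} (hf : MDifferentiableAt (𝓡 d) 𝓘(ℝ, ℝ) f x)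
    (hg : MDifferentiableAt (𝓡 d) 𝓘(ℝ, ℝ) g x) :
    diff (d := d) (fun y => f y + g y) x = diff f x + diff g x := mvfderiv_add hf hg

theorem diff_sub {f g : M → ℝ} {x : M} (hf : MDifferentiableAt (𝓡 d) 𝓘(ℝ, ℝ) f x)
    (hg : MDifferentiableAt (𝓡 d) 𝓘(ℝ, ℝ) g x) :
    diff (d := d) (fun y => f y - g y) x = diff f x - diff g x := mvfderiv_sub hf hg

theorem diff_mul {f g : M → ℝ} {x : M} (hf : MDifferentiableAt (𝓡 d) 𝓘(ℝ, ℝ) f x)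
    (hg : MDifferentiableAt (𝓡 d) 𝓘(ℝ, ℝ) g x) :
    diff (d := d) (fun y => f y * g y) x = f x • diff g x + g x • diff f x := mvfderiv_mul hf hg

theorem diff_const_mul (c : ℝ) {f : M → ℝ} {x : M} (hf : MDifferentiableAt (𝓡 d) 𝓘(ℝ, ℝ) f x) :
    diff (d := d) (fun y => c * f y) x = c • diff f x := by
  rw [diff_mul mdifferentiableAt_const hf, diff_const, smul_zero, add_zero]

theorem mdifferentiableAt_sum {ι : Type*} {s : Finset ι} {f : ι → M → ℝ} {x : M}
    (hf : ∀ a ∈ s, MDifferentiableAt (𝓡 d) 𝓘(ℝ, ℝ) (f a) x) :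
    MDifferentiableAt (𝓡 d) 𝓘(ℝ, ℝ) (fun y => ∑ a ∈ s, f a y) x := by
  classical
  induction s using Finset.induction_on with
  | empty => simpa using mdifferentiableAt_const
  | insert a s ha ih =>
    simp only [Finset.sum_insert ha]
    exact (hf a (by simp)).add (ih fun b hb => hf b (by simp [hb]))

theorem diff_sum {ι : Type*} {s : Finset ι} {f : ι → M → ℝ} {x : M}
    (hf : ∀ a ∈ s, MDifferentiableAt (𝓡 d) 𝓘(ℝ, ℝ) (f a) x) :
    diff (d := d) (fun y => ∑ a ∈ s, f a y) x = ∑ a ∈ s, diff (f a) x := by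
  classical
  induction s using Finset.induction_on with
  | empty => simpa using diff_const 0 x
  | insert a s ha ih =>
    have hs : ∀ b ∈ s, MDifferentiableAt (𝓡 d) 𝓘(ℝ, ℝ) (f b) x := fun b hb => hf b (by simp [hb])
    simp only [Finset.sum_insert ha]
    rw [diff_add (hf a (by simp)) (mdifferentiableAt_sum hs), ih hs]

theorem _root_.ContMDiffAt.mdiffAt {f : M → ℝ} {x : M} (hf : ContMDiffAt (𝓡 d) 𝓘(ℝ, ℝ) ∞ f x) :
    MDifferentiableAt (𝓡 d) 𝓘(ℝ, ℝ) f x := hf.mdifferentiableAt (by simp)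

theorem IsSmooth.mdiffAt {f : M → ℝ} (hf : IsSmooth (d := d) f) (x : M) :
    MDifferentiableAt (𝓡 d) 𝓘(ℝ, ℝ) f x := hf.contMDiffAt.mdiffAt

theorem hasFDerivAt_comp_symm_of_diff_eq_zero
    {ψ : OpenPartialHomeomorph M (EuclideanSpace ℝ (Fin d))}
    (hψ : ψ ∈ IsManifold.maximalAtlas (𝓡 d) ∞ M) {g : M → ℝ} {u : EuclideanSpace ℝ (Fin d)}
    (hu : u ∈ ψ.target) (hg : MDifferentiableAt (𝓡 d) 𝓘(ℝ, ℝ) g (ψ.symm u))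
    (h0 : diff (d := d) g (ψ.symm u) = 0) :
    HasFDerivAt (g ∘ ψ.symm) (0 : EuclideanSpace ℝ (Fin d) →L[ℝ] ℝ) u := by
  have h2 : MDifferentiableAt (𝓡 d) (𝓡 d) ψ.symm u :=
    (contMDiffAt_symm_of_mem_maximalAtlas hψ hu).mdifferentiableAt (by simp)
  have h3 := hg.hasMFDerivAt.comp u h2.hasMFDerivAt
  have h4 : mfderiv (𝓡 d) 𝓘(ℝ, ℝ) g (ψ.symm u) = 0 := by
    ext v
    exact congrArg (fun α => α v) h0
  rw [h4] at h3
  have h5 := h3.hasFDerivAt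
  convert! h5

variable [IsManifold (𝓡 d) ∞ M]

theorem IsSmooth.field_apply {f : M → ℝ} (hf : IsSmooth (d := d) f)
    {X : (x : M) → TangentSpace (𝓡 d) x} (hX : IsSmoothField X) :
    IsSmooth (d := d) (fun y => diff f y (X y)) := by
  have h1 := hf.contMDiff_tangentMap (m := ∞) (by simp)
  exact (contMDiff_snd_tangentBundle_modelSpace ℝ 𝓘(ℝ, ℝ)).comp (h1.comp hX)

theorem exists_chart_coord {f : M → ℝ} {V : Set M} (hV : IsOpen V)
    (hf : ContMDiffOn (𝓡 d) 𝓘(ℝ, ℝ) ∞ f V) {x : M} (hx : x ∈ V) (hd : diff (d := d) f x ≠ 0) :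
    ∃ φ ∈ IsManifold.maximalAtlas (𝓡 d) ∞ M, ∃ k : Fin d, x ∈ φ.source ∧ φ.source ⊆ V ∧
      ∀ y ∈ φ.source, φ y k = f y ∧ diff (d := d) f y ≠ 0 := by
  let ψ := chartAt (EuclideanSpace ℝ (Fin d)) x
  have hxψ : x ∈ ψ.source := mem_chart_source _ x
  let U := ψ.target ∩ ψ.symm ⁻¹' V
  have hU : IsOpen U := ψ.symm.isOpen_inter_preimage hV
  have hψ : ψ ∈ IsManifold.maximalAtlas (𝓡 d) ∞ M := IsManifold.chart_mem_maximalAtlas x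
  have hF : ContDiffOn ℝ ∞ (f ∘ ψ.symm) U :=
    (hf.comp ((contMDiffOn_symm_of_mem_maximalAtlas hψ).mono Set.inter_subset_left)
      (fun u hu => hu.2)).contDiffOn
  have ha : ψ x ∈ U := ⟨ψ.map_source hxψ, by simpa [ψ.left_inv hxψ] using hx⟩
  have hd' : fderiv ℝ (f ∘ ψ.symm) (ψ x) ≠ 0 := by
    intro h0
    apply hd
    refine (MDifferentiableAt.mvfderiv (hf.contMDiffAt (hV.mem_nhds hx)).mdiffAt).trans ?_
    simp only [ModelWithCorners.range_eq_univ, fderivWithin_univ]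
    exact h0
  obtain ⟨Φ, k, h1, h2, h3, h4, h5⟩ := exists_openPartialHomeomorph_coord hU hF ha hd'
  refine ⟨ψ.trans Φ, ?_, k, ?_, ?_, ?_⟩
  · refine OpenPartialHomeomorph.mem_maximalAtlas_of_contMDiffOn _ ?_ ?_
    · exact h3.contMDiffOn.comp ((contMDiffOn_of_mem_maximalAtlas hψ).mono (by simp))
        (by intro y hy; simpa using hy.2)
    · exact (contMDiffOn_symm_of_mem_maximalAtlas hψ).comp (h4.contMDiffOn.mono (by simp))
        (by intro y hy; simpa using hy.2)
  · simp [hxψ, h1]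
  · intro y hy
    have hy' : y ∈ ψ.source ∧ ψ y ∈ Φ.source := by simpa using hy
    have := (h2 hy'.2).2
    simpa [ψ.left_inv hy'.1] using this
  · intro y hy
    have hy' : y ∈ ψ.source ∧ ψ y ∈ Φ.source := by simpa using hy
    have hyV := (h2 hy'.2).2
    obtain ⟨h6, h7⟩ := h5 _ hy'.2
    refine ⟨by simpa [ψ.left_inv hy'.1] using h6, fun h8 => h7 ?_⟩
    refine (hasFDerivAt_comp_symm_of_diff_eq_zero hψ (h2 hy'.2).1
      (hf.contMDiffAt (hV.mem_nhds hyV)).mdiffAt ?_).fderiv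
    rwa [ψ.left_inv hy'.1]

/-- A linear function of the chart is cut off by a bump function. Identities between tensors are
only given on differentials of global smooth functions; this turns them into identities on all
covectors at a point. -/
theorem exists_isSmooth_diff_eq [T2Space M] (x : M) (α : TangentSpace (𝓡 d) x →L[ℝ] ℝ) :
    ∃ f : M → ℝ, IsSmooth (d := d) f ∧ diff f x = α := by
  let b : SmoothBumpFunction (𝓡 d) x := Classical.arbitrary _
  let α' : EuclideanSpace ℝ (Fin d) →L[ℝ] ℝ := α
  let ψ := chartAt (EuclideanSpace ℝ (Fin d)) x
  let g : M → ℝ := fun y => α' (ψ y)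
  have hg : ContMDiffOn (𝓡 d) 𝓘(ℝ, ℝ) ∞ g ψ.source :=
    α'.contDiff.contMDiff.comp_contMDiffOn contMDiffOn_chart
  refine ⟨fun y => b y • g y, b.contMDiff_smul hg, ?_⟩
  have h1 : (fun y => b y • g y) =ᶠ[𝓝 x] g := by
    filter_upwards [b.eventuallyEq_one] with y hy
    simp [hy]
  have hx : x ∈ ψ.source := mem_chart_source _ x
  refine (diff_congr h1).trans ((MDifferentiableAt.mvfderiv
    (hg.contMDiffAt (ψ.open_source.mem_nhds hx)).mdiffAt).trans ?_)
  have h2 : writtenInExtChartAt (𝓡 d) 𝓘(ℝ, ℝ) x g =ᶠ[𝓝 (extChartAt (𝓡 d) x x)] α' := by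
    filter_upwards [extChartAt_target_mem_nhds (I := 𝓡 d) x] with u hu
    have : ψ (ψ.symm u) = u := ψ.right_inv (by simpa [extChartAt] using hu)
    simp [writtenInExtChartAt, g, extChartAt]
    exact congrArg α' this
  simp only [ModelWithCorners.range_eq_univ, fderivWithin_univ]
  rw [h2.fderiv_eq]
  exact α'.fderiv

theorem eventually_eq_of_diff_eq_zero {g : M → ℝ} {x : M} {V : Set M} (hV : IsOpen V) (hx : x ∈ V)
    (hg : ∀ y ∈ V, MDifferentiableAt (𝓡 d) 𝓘(ℝ, ℝ) g y)
    (h0 : ∀ y ∈ V, diff (d := d) g y = 0) :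
    ∀ᶠ y in 𝓝 x, g y = g x := by
  let ψ := chartAt (EuclideanSpace ℝ (Fin d)) x
  have hxψ : x ∈ ψ.source := mem_chart_source _ x
  let U := ψ.target ∩ ψ.symm ⁻¹' V
  have hU : IsOpen U := ψ.symm.isOpen_inter_preimage hV
  have hψ : ψ ∈ IsManifold.maximalAtlas (𝓡 d) ∞ M := IsManifold.chart_mem_maximalAtlas x
  have ha : ψ x ∈ U := ⟨ψ.map_source hxψ, by simpa [ψ.left_inv hxψ] using hx⟩
  have hD : ∀ u ∈ U, HasFDerivAt (g ∘ ψ.symm) (0 : EuclideanSpace ℝ (Fin d) →L[ℝ] ℝ) u :=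
    fun u hu => hasFDerivAt_comp_symm_of_diff_eq_zero hψ hu.1 (hg _ hu.2) (h0 _ hu.2)
  obtain ⟨r, hr, hball⟩ := Metric.isOpen_iff.1 hU _ ha
  have hc : ∀ u ∈ Metric.ball (ψ x) r, (g ∘ ψ.symm) u = (g ∘ ψ.symm) (ψ x) := fun u hu =>
    Metric.isOpen_ball.is_const_of_fderiv_eq_zero (convex_ball (ψ x) r).isPreconnected
      (fun v hv => (hD v (hball hv)).differentiableAt.differentiableWithinAt)
      (fun v hv => (hD v (hball hv)).fderiv) hu (Metric.mem_ball_self hr)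
  have hc1 : ContinuousAt ψ x := ψ.continuousAt hxψ
  filter_upwards [hc1.preimage_mem_nhds (Metric.ball_mem_nhds _ hr),
    ψ.open_source.mem_nhds hxψ] with y hy hys
  have := hc _ hy
  simpa [ψ.left_inv hys, ψ.left_inv hxψ] using this

end Calculus

/-! ### Smoothness of determinants, adjugates and quotients -/

section Smoothness

variable {d : ℕ} {M : Type*} [TopologicalSpace M] [ChartedSpace (EuclideanSpace ℝ (Fin d)) M]

theorem contMDiffAt_det {m : ℕ} {A : M → Matrix (Fin m) (Fin m) ℝ} {x : M}
    (hA : ∀ i j, ContMDiffAt (𝓡 d) 𝓘(ℝ, ℝ) ∞ (fun y => A y i j) x) :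
    ContMDiffAt (𝓡 d) 𝓘(ℝ, ℝ) ∞ (fun y => (A y).det) x := by
  simp only [Matrix.det_apply']
  exact ContMDiffAt.sum fun σ _ => contMDiffAt_const.mul (contMDiffAt_finsetProd fun i _ => hA _ _)

theorem contMDiffAt_adjugate {m : ℕ} {A : M → Matrix (Fin m) (Fin m) ℝ} {x : M}
    (hA : ∀ i j, ContMDiffAt (𝓡 d) 𝓘(ℝ, ℝ) ∞ (fun y => A y i j) x) (i j : Fin m) :
    ContMDiffAt (𝓡 d) 𝓘(ℝ, ℝ) ∞ (fun y => (A y).adjugate i j) x := by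
  simp only [Matrix.adjugate_apply]
  refine contMDiffAt_det fun k l => ?_
  by_cases h : k = j
  · subst h
    simpa using contMDiffAt_const
  · simpa [Matrix.updateRow_ne h] using hA k l

theorem _root_.ContMDiffAt.div_of_ne {f g : M → ℝ} {x : M} (hf : ContMDiffAt (𝓡 d) 𝓘(ℝ, ℝ) ∞ f x)
    (hg : ContMDiffAt (𝓡 d) 𝓘(ℝ, ℝ) ∞ g x) (h0 : g x ≠ 0) :
    ContMDiffAt (𝓡 d) 𝓘(ℝ, ℝ) ∞ (fun y => f y / g y) x := by
  have h1 : ContMDiffAt 𝓘(ℝ, ℝ) 𝓘(ℝ, ℝ) ∞ (fun t : ℝ => t⁻¹) (g x) :=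
    (contDiffAt_inv ℝ h0).contMDiffAt
  simp only [div_eq_mul_inv]
  exact hf.mul (h1.comp x hg)

end Smoothness

/-! ### Linear algebra and smoothness in the frame of common eigenvectors -/

theorem evaluation_bijective {d : ℕ} {e : Fin (d + 1) → EuclideanSpace ℝ (Fin (d + 1))}
    (he : LinearIndependent ℝ e) :
    Function.Bijective (fun (α : EuclideanSpace ℝ (Fin (d + 1)) →L[ℝ] ℝ) k => α (e k)) := by
  let b := basisOfLinearIndependentOfCardEqFinrank he (by simp)
  have hb : ∀ k, b k = e k := fun k => by simp [b]
  constructor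
  · intro α β h
    refine ContinuousLinearMap.coe_injective (b.ext fun k => ?_)
    simpa [hb] using congrFun h k
  · intro c
    refine ⟨(b.constr ℝ c).toContinuousLinearMap, funext fun k => ?_⟩
    simp [← hb]

section Frame

variable {n : ℕ} {M : Type*} [TopologicalSpace M]
  [ChartedSpace (EuclideanSpace ℝ (Fin (n + 1))) M] [IsManifold (𝓡 (n + 1)) ∞ M]
  {G : Metric (n + 1) M} (B : CKBasis G)

namespace CKBasis

/-- Covectors at `x` are given by their values on the frame. -/
def coframe (x : M) : (TangentSpace (𝓡 (n + 1)) x →L[ℝ] ℝ) ≃ₗ[ℝ] (Fin (n + 1) → ℝ) :=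
  LinearEquiv.ofBijective
    { toFun := fun (α : TangentSpace (𝓡 (n + 1)) x →L[ℝ] ℝ) k => α (B.E k x)
      map_add' := fun _ _ => rfl
      map_smul' := fun _ _ => rfl } (evaluation_bijective (B.frame x))

@[simp] theorem coframe_apply (x : M) (α : TangentSpace (𝓡 (n + 1)) x →L[ℝ] ℝ) (k : Fin (n + 1)) :
    B.coframe x α k = α (B.E k x) := rfl

/-- The coframe dual to the frame of eigenvectors. -/
def dual (k : Fin (n + 1)) (x : M) : TangentSpace (𝓡 (n + 1)) x →L[ℝ] ℝ :=
  (B.coframe x).symm (Pi.single k 1)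

theorem dual_apply (k l : Fin (n + 1)) (x : M) :
    B.dual k x (B.E l x) = if l = k then 1 else 0 := by
  rw [← coframe_apply, dual, LinearEquiv.apply_symm_apply, Pi.single_apply]

theorem covector_ext {x : M} {α β : TangentSpace (𝓡 (n + 1)) x →L[ℝ] ℝ}
    (h : ∀ k, α (B.E k x) = β (B.E k x)) : α = β :=
  (B.coframe x).injective (funext h)

theorem covector_eq_sum (x : M) (α : TangentSpace (𝓡 (n + 1)) x →L[ℝ] ℝ) :
    α = ∑ k, α (B.E k x) • B.dual k x := by
  refine B.covector_ext fun l => ?_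
  simp [B.dual_apply]

/-- The contravariant metric coefficients in the frame of eigenvectors. -/
def eps (k : Fin (n + 1)) (x : M) : ℝ := G.form x (B.dual k x) (B.dual k x)

/-- By nondegeneracy the lowered covector is unique, so one `θ` serves all the tensors `K a`. -/
theorem exists_lowered (i : Fin (n + 1)) (x : M) :
    ∃ θ, IsLowered G.toSymTensor x (B.E i x) θ ∧
      ∀ a β, (B.K a).form x θ β = B.eigenvalue a i x * β (B.E i x) := by
  obtain ⟨θ, hθ, -⟩ := (B.eigen 0 i x).2
  refine ⟨θ, hθ, fun a => ?_⟩
  obtain ⟨θ', hθ', h⟩ := (B.eigen a i x).2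
  have : θ - θ' = 0 := G.nondegenerate x _ fun β => by
    rw [map_sub, LinearMap.sub_apply, hθ β, hθ' β, sub_self]
  rwa [sub_eq_zero.1 this]

/-- The eigenvectors with lowered index. -/
def lowered (i : Fin (n + 1)) (x : M) : TangentSpace (𝓡 (n + 1)) x →L[ℝ] ℝ :=
  (B.exists_lowered i x).choose

theorem isLowered_lowered (i : Fin (n + 1)) (x : M) :
    IsLowered G.toSymTensor x (B.E i x) (B.lowered i x) := (B.exists_lowered i x).choose_spec.1

theorem form_lowered (a i : Fin (n + 1)) (x : M) (β : TangentSpace (𝓡 (n + 1)) x →L[ℝ] ℝ) :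
    (B.K a).form x (B.lowered i x) β = B.eigenvalue a i x * β (B.E i x) :=
  (B.exists_lowered i x).choose_spec.2 a β

theorem eigenvalue_last (i : Fin (n + 1)) (x : M) : B.eigenvalue (Fin.last n) i x = 1 := by
  have h1 := B.form_lowered (Fin.last n) i x (B.dual i x)
  rw [B.K_last, B.isLowered_lowered i x, B.dual_apply] at h1
  simpa using h1.symm

theorem linearIndependent_lowered (x : M) : LinearIndependent ℝ (fun i => B.lowered i x) := by
  rw [Fintype.linearIndependent_iff]
  intro c hc i
  have h := congrArg (fun α => G.form x α (B.dual i x)) hc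
  have h1 : ∀ j, G.form x (B.lowered j x) (B.dual i x) = if j = i then 1 else 0 := fun j =>
    (B.isLowered_lowered j x _).trans (B.dual_apply i j x)
  simpa [map_sum, LinearMap.sum_apply, h1] using h

theorem span_lowered (x : M) : Submodule.span ℝ (Set.range fun i => B.lowered i x) = ⊤ := by
  have : Module.Finite ℝ (TangentSpace (𝓡 (n + 1)) x →L[ℝ] ℝ) :=
    Module.Finite.equiv (B.coframe x).symm
  refine (B.linearIndependent_lowered x).span_eq_top_of_card_eq_finrank' ?_
  rw [(B.coframe x).finrank_eq]
  simp

/-- A linear relation between the rows of `Λ` gives a combination of the `K a` that vanishes on all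
lowered eigenvectors. These span the covectors, so it contradicts pointwise independence. -/
theorem det_Lam_ne_zero (x : M) : (B.Lam x).det ≠ 0 := by
  intro h
  obtain ⟨c, hc, h0⟩ := Matrix.exists_vecMul_eq_zero_iff.2 h
  apply hc
  refine funext (Fintype.linearIndependent_iff.1 (B.independent x) c (funext fun p => ?_))
  obtain ⟨α, β⟩ := p
  have hα : α ∈ Submodule.span ℝ (Set.range fun i => B.lowered i x) := by
    rw [B.span_lowered]; trivial
  simp only [Finset.sum_apply, Pi.smul_apply, smul_eq_mul, Pi.zero_apply]
  induction hα using Submodule.span_induction with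
  | mem α hα =>
    obtain ⟨i, rfl⟩ := hα
    have := congrFun h0 i
    simp only [B.form_lowered, ← mul_assoc, ← Finset.sum_mul]
    rw [show ∑ a, c a * B.eigenvalue a i x = 0 from this, zero_mul]
  | zero => simp
  | add α₁ α₂ _ _ h1 h2 => simp [mul_add, Finset.sum_add_distrib, h1, h2]
  | smul t α _ h1 => simp [mul_left_comm _ t, ← Finset.mul_sum, h1]

/-- Eigenvectors of a symmetric tensor that are not orthogonal have the same eigenvalue. If this
occurred for every `K a`, two columns of `Λ` would coincide. -/
theorem lowered_apply_of_ne {i k : Fin (n + 1)} (hik : i ≠ k) (x : M) :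
    B.lowered i x (B.E k x) = 0 := by
  by_contra h
  have h1 : ∀ a, B.eigenvalue a i x = B.eigenvalue a k x := by
    intro a
    have h2 := B.form_lowered a i x (B.lowered k x)
    have h3 := B.form_lowered a k x (B.lowered i x)
    have h4 := B.isLowered_lowered i x (B.lowered k x)
    have h5 := B.isLowered_lowered k x (B.lowered i x)
    rw [G.symm] at h5
    rw [(B.K a).symm, h3] at h2
    rw [← h4, h5] at h2
    exact (mul_right_cancel₀ h h2).symm
  exact B.det_Lam_ne_zero x (Matrix.det_zero_of_column_eq hik h1)

/-- A null `E_i` would be orthogonal to the whole frame, hence zero. This holds in any signature. -/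
theorem lowered_apply_self_ne_zero (i : Fin (n + 1)) (x : M) : B.lowered i x (B.E i x) ≠ 0 := by
  intro h
  have h0 : B.lowered i x = 0 := B.covector_ext fun k => by
    by_cases hk : i = k
    · subst hk; simpa using h
    · simpa using B.lowered_apply_of_ne hk x
  have := B.isLowered_lowered i x (B.dual i x)
  rw [h0, B.dual_apply] at this
  simp at this

theorem lowered_eq (i : Fin (n + 1)) (x : M) :
    B.lowered i x = B.lowered i x (B.E i x) • B.dual i x := by
  refine B.covector_ext fun k => ?_
  by_cases hk : i = k
  · subst hk; simp [B.dual_apply]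
  · simp [B.dual_apply, B.lowered_apply_of_ne hk x, Ne.symm hk]

theorem form_dual (a i : Fin (n + 1)) (x : M) (β : TangentSpace (𝓡 (n + 1)) x →L[ℝ] ℝ) :
    B.lowered i x (B.E i x) * (B.K a).form x (B.dual i x) β =
      B.eigenvalue a i x * β (B.E i x) := by
  rw [← B.form_lowered, B.lowered_eq i x]
  simp [B.dual_apply]

theorem lowered_mul_eps (i : Fin (n + 1)) (x : M) : B.lowered i x (B.E i x) * B.eps i x = 1 := by
  have := B.form_dual (Fin.last n) i x (B.dual i x)
  rw [B.K_last, B.eigenvalue_last, B.dual_apply] at this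
  simpa [eps] using this

theorem eps_ne_zero (i : Fin (n + 1)) (x : M) : B.eps i x ≠ 0 :=
  right_ne_zero_of_mul_eq_one (B.lowered_mul_eps i x)

theorem form_eq_sum (a : Fin (n + 1)) (x : M) (α β : TangentSpace (𝓡 (n + 1)) x →L[ℝ] ℝ) :
    (B.K a).form x α β =
      ∑ k, B.eigenvalue a k x * B.eps k x * (α (B.E k x) * β (B.E k x)) := by
  conv_lhs => rw [B.covector_eq_sum x α]
  simp only [map_sum, map_smul, LinearMap.sum_apply, LinearMap.smul_apply, smul_eq_mul]
  refine Finset.sum_congr rfl fun k _ => ?_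
  refine mul_left_cancel₀ (B.lowered_apply_self_ne_zero k x) ?_
  have h1 := B.form_dual a k x β
  have h2 := B.lowered_mul_eps k x
  linear_combination α (B.E k x) * h1 - B.eigenvalue a k x * β (B.E k x) * α (B.E k x) * h2

theorem metric_form_eq_sum (x : M) (α β : TangentSpace (𝓡 (n + 1)) x →L[ℝ] ℝ) :
    G.form x α β = ∑ k, B.eps k x * (α (B.E k x) * β (B.E k x)) := by
  have := B.form_eq_sum (Fin.last n) x α β
  rw [B.K_last] at this
  simpa [B.eigenvalue_last] using this

/-- The derivative of a function along a vector of the frame. -/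
def deriv (k : Fin (n + 1)) (f : M → ℝ) (x : M) : ℝ := diff f x (B.E k x)

theorem isSmooth_deriv (k : Fin (n + 1)) {f : M → ℝ} (hf : IsSmooth (d := n + 1) f) :
    IsSmooth (d := n + 1) (B.deriv k f) := hf.field_apply (B.smooth_E k)

theorem quad_eq_sum (a : Fin (n + 1)) (f : M → ℝ) (x : M) :
    (B.K a).quad f x = ∑ k, B.eigenvalue a k x * B.eps k x * B.deriv k f x ^ 2 := by
  simp only [SymTensor.quad, B.form_eq_sum, deriv, pow_two]

theorem metric_quad_eq_sum (f : M → ℝ) (x : M) :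
    G.quad f x = ∑ k, B.eps k x * B.deriv k f x ^ 2 := by
  simp only [SymTensor.quad, B.metric_form_eq_sum, deriv, pow_two]

variable [T2Space M]

/-- Around every point there are functions whose differentials there form the dual coframe. -/
theorem exists_dual_functions (x : M) : ∃ f : Fin (n + 1) → M → ℝ,
    (∀ l, IsSmooth (d := n + 1) (f l)) ∧ ∀ k l, B.deriv k (f l) x = if k = l then 1 else 0 := by
  choose f hf hd using fun l => exists_isSmooth_diff_eq (d := n + 1) x (B.dual l x)
  exact ⟨f, hf, fun k l => by rw [deriv, hd, B.dual_apply]⟩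

/-- The product is `K_a` on the `k`-th dual covector. Near `x` that covector is a combination of
differentials of global functions, with smooth coefficients taken from an inverse matrix. -/
theorem isSmooth_eigenvalue_mul_eps (a k : Fin (n + 1)) :
    IsSmooth (d := n + 1) (fun x => B.eigenvalue a k x * B.eps k x) := by
  intro x
  obtain ⟨f, hf, hd⟩ := B.exists_dual_functions x
  let W : M → Matrix (Fin (n + 1)) (Fin (n + 1)) ℝ := fun y => Matrix.of fun r l => B.deriv r (f l) y
  have hW : ∀ r l y, ContMDiffAt (𝓡 (n + 1)) 𝓘(ℝ, ℝ) ∞ (fun y => W y r l) y := fun r l y =>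
    (B.isSmooth_deriv r (hf l)).contMDiffAt
  have hWx : W x = 1 := by
    ext r l
    simp [W, hd, Matrix.one_apply]
  have hdet : ∀ᶠ y in 𝓝 x, (W y).det ≠ 0 :=
    (contMDiffAt_det fun r l => hW r l x).continuousAt.eventually_ne (by simp [hWx])
  -- The `k`-th column of the inverse of `W`, so that `∑ l, R l • d(f l)` is the `k`-th dual
  -- covector.
  let R : Fin (n + 1) → M → ℝ := fun l y => (W y).adjugate l k / (W y).det
  have hR : ∀ l, ContMDiffAt (𝓡 (n + 1)) 𝓘(ℝ, ℝ) ∞ (R l) x := fun l =>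
    (contMDiffAt_adjugate (fun r l => hW r l x) l k).div_of_ne (contMDiffAt_det fun r l => hW r l x)
      (by simp [hWx])
  have hWR : ∀ y, (W y).det ≠ 0 → ∀ r, ∑ l, W y r l * R l y = if r = k then 1 else 0 := by
    intro y hy r
    have h1 := congrFun (congrFun (Matrix.mul_adjugate (W y)) r) k
    simp only [Matrix.mul_apply, Matrix.smul_apply, Matrix.one_apply, smul_eq_mul] at h1
    simp only [R, ← mul_div_assoc, ← Finset.sum_div, h1]
    split_ifs <;> simp [hy]
  have hsm : ContMDiffAt (𝓡 (n + 1)) 𝓘(ℝ, ℝ) ∞ (fun y => ∑ l, ∑ m,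
      R l y * R m y * (B.K a).form y (diff (f l) y) (diff (f m) y)) x :=
    ContMDiffAt.sum fun l _ => ContMDiffAt.sum fun m _ =>
      ((hR l).mul (hR m)).mul ((B.K a).smooth _ _ (hf l) (hf m)).contMDiffAt
  refine hsm.congr_of_eventuallyEq ?_
  filter_upwards [hdet] with y hy
  have h2 : ∀ l m, (B.K a).form y (diff (f l) y) (diff (f m) y) =
      ∑ r, B.eigenvalue a r y * B.eps r y * (W y r l * W y r m) := fun l m => B.form_eq_sum a y _ _
  have h3 : ∑ l, ∑ m, R l y * R m y * (B.K a).form y (diff (f l) y) (diff (f m) y) =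
      ∑ r, B.eigenvalue a r y * B.eps r y * ((∑ l, W y r l * R l y) * ∑ m, W y r m * R m y) := by
    simp only [h2, Finset.sum_mul_sum]
    simp only [Finset.mul_sum]
    calc _ = ∑ l, ∑ r, ∑ m, R l y * R m y *
          (B.eigenvalue a r y * B.eps r y * (W y r l * W y r m)) :=
          Finset.sum_congr rfl fun l _ => Finset.sum_comm
      _ = ∑ r, ∑ l, ∑ m, R l y * R m y *
          (B.eigenvalue a r y * B.eps r y * (W y r l * W y r m)) := Finset.sum_comm
      _ = _ := Finset.sum_congr rfl fun r _ => Finset.sum_congr rfl fun l _ =>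
          Finset.sum_congr rfl fun m _ => by ring
  rw [h3]
  simp [hWR y hy]

theorem isSmooth_eps (k : Fin (n + 1)) : IsSmooth (d := n + 1) (B.eps k) := by
  simpa [B.eigenvalue_last] using B.isSmooth_eigenvalue_mul_eps (Fin.last n) k

theorem isSmooth_eigenvalue (a k : Fin (n + 1)) : IsSmooth (d := n + 1) (B.eigenvalue a k) := by
  intro x
  have := (B.isSmooth_eigenvalue_mul_eps a k x).div_of_ne (B.isSmooth_eps k x) (B.eps_ne_zero k x)
  simpa [mul_div_cancel_right₀ _ (B.eps_ne_zero k _)] using this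

end CKBasis

end Frame

/-! ### The conformal Killing equation in the frame -/

section ConformalKilling

variable {n : ℕ} {M : Type*} [TopologicalSpace M]
  [ChartedSpace (EuclideanSpace ℝ (Fin (n + 1))) M] [IsManifold (𝓡 (n + 1)) ∞ M]
  {G : Metric (n + 1) M} (B : CKBasis G)

namespace CKBasis

theorem diff_E (k : Fin (n + 1)) (f : M → ℝ) (x : M) : diff f x (B.E k x) = B.deriv k f x := rfl

theorem deriv_lin_comb (m : Fin (n + 1)) {f g : M → ℝ} (hf : IsSmooth (d := n + 1) f)
    (hg : IsSmooth (d := n + 1) g) (s t : ℝ) :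
    B.deriv m (fun y => s * f y + t * g y) = fun y => s * B.deriv m f y + t * B.deriv m g y := by
  funext y
  have h1 : MDifferentiableAt (𝓡 (n + 1)) 𝓘(ℝ, ℝ) (fun y => s * f y) y :=
    mdifferentiableAt_const.mul (hf.mdiffAt y)
  have h2 : MDifferentiableAt (𝓡 (n + 1)) 𝓘(ℝ, ℝ) (fun y => t * g y) y :=
    mdifferentiableAt_const.mul (hg.mdiffAt y)
  simp only [deriv]
  rw [diff_add h1 h2, diff_const_mul s (hf.mdiffAt y), diff_const_mul t (hg.mdiffAt y)]
  rfl

theorem diff_sum_mul_sq {u : Fin (n + 1) → M → ℝ} {x : M}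
    (hu : ∀ r, MDifferentiableAt (𝓡 (n + 1)) 𝓘(ℝ, ℝ) (u r) x) {f : M → ℝ}
    (hf : IsSmooth (d := n + 1) f) (v : TangentSpace (𝓡 (n + 1)) x) :
    diff (fun y => ∑ r, u r y * B.deriv r f y ^ 2) x v =
      ∑ r, (diff (u r) x v * B.deriv r f x ^ 2 +
        2 * u r x * B.deriv r f x * diff (B.deriv r f) x v) := by
  have hp : ∀ r, MDifferentiableAt (𝓡 (n + 1)) 𝓘(ℝ, ℝ) (B.deriv r f) x := fun r =>
    (B.isSmooth_deriv r hf).mdiffAt x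
  have hp2 : ∀ r, MDifferentiableAt (𝓡 (n + 1)) 𝓘(ℝ, ℝ)
      (fun y => B.deriv r f y * B.deriv r f y) x := fun r => (hp r).mul (hp r)
  simp only [pow_two]
  rw [diff_sum (f := fun r y => u r y * (B.deriv r f y * B.deriv r f y))
    fun r _ => (hu r).mul (hp2 r), sum_apply]
  refine Finset.sum_congr rfl fun r _ => ?_
  rw [diff_mul (hu r) (hp2 r), diff_mul (hp r) (hp r)]
  simp only [add_apply, smul_apply, smul_eq_mul]
  ring

theorem sum_mul_pair {k l : Fin (n + 1)} (s t : ℝ) (Y : Fin (n + 1) → ℝ) :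
    ∑ m, (s * (if m = k then 1 else 0) + t * (if m = l then 1 else 0)) * Y m
      = s * Y k + t * Y l := by
  simp [add_mul, Finset.sum_add_distrib]

theorem sum_mul_pair_sq {k l : Fin (n + 1)} (hkl : k ≠ l) (s t : ℝ) (Y : Fin (n + 1) → ℝ) :
    ∑ m, Y m * (s * (if m = k then 1 else 0) + t * (if m = l then 1 else 0)) ^ 2
      = s ^ 2 * Y k + t ^ 2 * Y l := by
  have : ∀ m, Y m * (s * (if m = k then 1 else 0) + t * (if m = l then 1 else 0)) ^ 2 =
      (s ^ 2 * (if m = k then 1 else 0) + t ^ 2 * (if m = l then 1 else 0)) * Y m := by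
    intro m
    by_cases h1 : m = k
    · have h2 : m ≠ l := fun h => hkl (h1.symm.trans h)
      simp only [h1, if_true, hkl, if_false]; ring
    · by_cases h2 : m = l
      · simp only [h2, hkl.symm, if_false, if_true]; ring
      · simp [h1, h2]
  simp only [this, sum_mul_pair]

variable [T2Space M]

theorem diff_metric_quad {f : M → ℝ} (hf : IsSmooth (d := n + 1) f) (x : M)
    (v : TangentSpace (𝓡 (n + 1)) x) :
    diff (G.quad f) x v = ∑ r, (diff (B.eps r) x v * B.deriv r f x ^ 2 +
      2 * B.eps r x * B.deriv r f x * diff (B.deriv r f) x v) := by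
  rw [← B.diff_sum_mul_sq (fun r => (B.isSmooth_eps r).mdiffAt x) hf v]
  congr 2
  exact funext fun y => B.metric_quad_eq_sum f y

theorem diff_quad (a : Fin (n + 1)) {f : M → ℝ} (hf : IsSmooth (d := n + 1) f) (x : M)
    (v : TangentSpace (𝓡 (n + 1)) x) :
    diff ((B.K a).quad f) x v =
      ∑ r, ((B.eigenvalue a r x * diff (B.eps r) x v + B.eps r x * diff (B.eigenvalue a r) x v) *
        B.deriv r f x ^ 2 +
      2 * (B.eigenvalue a r x * B.eps r x) * B.deriv r f x * diff (B.deriv r f) x v) := by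
  have h := B.diff_sum_mul_sq (fun r => (B.isSmooth_eigenvalue_mul_eps a r).mdiffAt x) hf v
  rw [show (B.K a).quad f = fun y => ∑ r, B.eigenvalue a r y * B.eps r y * B.deriv r f y ^ 2 from
    funext fun y => B.quad_eq_sum a f y, h]
  refine Finset.sum_congr rfl fun r _ => ?_
  rw [diff_mul ((B.isSmooth_eigenvalue a r).mdiffAt x) ((B.isSmooth_eps r).mdiffAt x)]
  simp only [add_apply, smul_apply, smul_eq_mul]

/-- The logarithmic derivative, along `E_k`, of the differences of the eigenvalues belonging to
`E_l` and `E_k`. The function `φ` is to have the differential dual to `E_l`. -/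
def connectionCoeff (k l : Fin (n + 1)) (φ : M → ℝ) (x : M) : ℝ :=
  (B.deriv k (B.eps l) x +
    2 * B.eps l x * (B.deriv k (B.deriv l φ) x - B.deriv l (B.deriv k φ) x)) / B.eps l x

/-- The conformal Killing equation, in the frame of eigenvectors. -/
theorem deriv_eigenvalue_sub {k l : Fin (n + 1)} (hkl : k ≠ l) {φ : M → ℝ} {x : M}
    (hφ : IsSmooth (d := n + 1) φ) (hφx : ∀ m, B.deriv m φ x = if m = l then 1 else 0)
    (a : Fin (n + 1)) :
    B.deriv k (B.eigenvalue a l) x - B.deriv k (B.eigenvalue a k) x =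
      B.connectionCoeff k l φ x * (B.eigenvalue a k x - B.eigenvalue a l x) := by
  obtain ⟨g, hg, hgx⟩ := B.exists_dual_functions x
  obtain ⟨ψ, hψ, hψx⟩ : ∃ ψ : M → ℝ, IsSmooth (d := n + 1) ψ ∧
      ∀ m, B.deriv m ψ x = if m = k then 1 else 0 := ⟨g k, hg k, fun m => hgx m k⟩
  obtain ⟨C, hC⟩ := B.isCKT a
  -- The cubic identity is evaluated on `s • dual k + t • dual l`, which makes it a polynomial
  -- identity in `s` and `t`.
  have key : ∀ s t : ℝ, _ := fun s t => hC (fun y => s * ψ y + t * φ y)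
    ((contMDiff_const.mul hψ).add (contMDiff_const.mul hφ)) x
  have hdiff : ∀ s t : ℝ, diff (d := n + 1) (fun y => s * ψ y + t * φ y) x =
      s • diff ψ x + t • diff φ x := by
    intro s t
    refine B.covector_ext fun m => ?_
    exact congrFun (B.deriv_lin_comb m hψ hφ s t) x
  have hsm : ∀ s t : ℝ, IsSmooth (d := n + 1) (fun y => s * ψ y + t * φ y) := fun s t =>
    (contMDiff_const.mul hψ).add (contMDiff_const.mul hφ)
  have h2 : ∀ (s t : ℝ) m r, B.deriv m (B.deriv r (fun y => s * ψ y + t * φ y)) x =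
      s * B.deriv m (B.deriv r ψ) x + t * B.deriv m (B.deriv r φ) x := by
    intro s t m r
    rw [B.deriv_lin_comb r hψ hφ, B.deriv_lin_comb m (B.isSmooth_deriv r hψ)
      (B.isSmooth_deriv r hφ)]
  have hGq : ∀ (s t : ℝ) m, diff (G.quad fun y => s * ψ y + t * φ y) x (B.E m x) =
      s ^ 2 * B.deriv m (B.eps k) x + t ^ 2 * B.deriv m (B.eps l) x +
      2 * (s * (B.eps k x * (s * B.deriv m (B.deriv k ψ) x + t * B.deriv m (B.deriv k φ) x)) +
        t * (B.eps l x * (s * B.deriv m (B.deriv l ψ) x + t * B.deriv m (B.deriv l φ) x))) := by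
    intro s t m
    rw [B.diff_metric_quad (hsm s t), Finset.sum_add_distrib]
    simp only [B.deriv_lin_comb _ hψ hφ, hψx, hφx]
    rw [sum_mul_pair_sq hkl]
    simp only [← B.deriv_lin_comb _ hψ hφ]
    rw [← sum_mul_pair (k := k) (l := l) s t (fun r => B.eps r x *
      (s * B.deriv m (B.deriv r ψ) x + t * B.deriv m (B.deriv r φ) x)), Finset.mul_sum]
    congr 1
    refine Finset.sum_congr rfl fun r _ => ?_
    rw [← h2 s t m r]
    simp only [deriv]
    ring
  have hKq : ∀ (s t : ℝ) m, diff ((B.K a).quad fun y => s * ψ y + t * φ y) x (B.E m x) =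
      s ^ 2 * (B.eigenvalue a k x * B.deriv m (B.eps k) x +
        B.eps k x * B.deriv m (B.eigenvalue a k) x) +
      t ^ 2 * (B.eigenvalue a l x * B.deriv m (B.eps l) x +
        B.eps l x * B.deriv m (B.eigenvalue a l) x) +
      2 * (s * (B.eigenvalue a k x * B.eps k x *
          (s * B.deriv m (B.deriv k ψ) x + t * B.deriv m (B.deriv k φ) x)) +
        t * (B.eigenvalue a l x * B.eps l x *
          (s * B.deriv m (B.deriv l ψ) x + t * B.deriv m (B.deriv l φ) x))) := by
    intro s t m
    rw [B.diff_quad a (hsm s t), Finset.sum_add_distrib]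
    simp only [B.deriv_lin_comb _ hψ hφ, hψx, hφx]
    rw [sum_mul_pair_sq hkl]
    simp only [← B.deriv_lin_comb _ hψ hφ]
    rw [← sum_mul_pair (k := k) (l := l) s t (fun r => B.eigenvalue a r x * B.eps r x *
      (s * B.deriv m (B.deriv r ψ) x + t * B.deriv m (B.deriv r φ) x)), Finset.mul_sum]
    congr 1
    refine Finset.sum_congr rfl fun r _ => ?_
    rw [← h2 s t m r]
    simp only [deriv]
    ring
  have hq : ∀ s t : ℝ, G.quad (fun y => s * ψ y + t * φ y) x =
      s ^ 2 * B.eps k x + t ^ 2 * B.eps l x := by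
    intro s t
    rw [B.metric_quad_eq_sum]
    simp only [B.deriv_lin_comb _ hψ hφ, hψx, hφx]
    rw [sum_mul_pair_sq hkl]
  have hform : ∀ (s t : ℝ) (β : TangentSpace (𝓡 (n + 1)) x →L[ℝ] ℝ) (b : Fin (n + 1)),
      (B.K b).form x (s • diff ψ x + t • diff φ x) β =
      s * (B.eigenvalue b k x * B.eps k x * β (B.E k x)) +
      t * (B.eigenvalue b l x * B.eps l x * β (B.E l x)) := by
    intro s t β b
    rw [B.form_eq_sum, ← sum_mul_pair (k := k) (l := l) s t
      (fun r => B.eigenvalue b r x * B.eps r x * β (B.E r x))]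
    refine Finset.sum_congr rfl fun m _ => ?_
    have h1 := hψx m
    have h3 := hφx m
    simp only [deriv] at h1 h3
    simp only [add_apply, smul_apply, smul_eq_mul, h1, h3]
    ring
  have hformG : ∀ (s t : ℝ) (β : TangentSpace (𝓡 (n + 1)) x →L[ℝ] ℝ),
      G.form x (s • diff ψ x + t • diff φ x) β =
      s * (B.eps k x * β (B.E k x)) + t * (B.eps l x * β (B.E l x)) := by
    intro s t β
    have := hform s t β (Fin.last n)
    rw [B.K_last] at this
    simpa [B.eigenvalue_last] using this
  simp only [schouten, symProd] at key
  simp only [hq, hdiff, hform, hformG, hGq, hKq, add_apply,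
    smul_apply, smul_eq_mul] at key
  -- `e1` is the coefficient of `s³` and `e2 + e3 - 2 * e1` is twice that of `s t²`. Both contain
  -- the `k`-th component of `C`, which is eliminated between them.
  have e1 := key 1 0
  have e2 := key 1 1
  have e3 := key 1 (-1)
  have hk := B.eps_ne_zero k x
  have hl := B.eps_ne_zero l x
  rw [connectionCoeff, div_mul_eq_mul_div, eq_div_iff hl]
  refine mul_left_cancel₀ hk ?_
  refine mul_left_cancel₀ hk ?_
  linear_combination -B.eps k x * (e2 + e3 - 2 * e1) / 4 + B.eps l x * e1 / 2

end CKBasis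

end ConformalKilling

/-! ### The fundamental functions as quotients of adjugate entries -/

section FundamentalFunctions

variable {n : ℕ} {M : Type*} [TopologicalSpace M]
  [ChartedSpace (EuclideanSpace ℝ (Fin (n + 1))) M] [IsManifold (𝓡 (n + 1)) ∞ M]
  {G : Metric (n + 1) M} (B : CKBasis G)

namespace CKBasis

theorem adjugate_Lam (i j : Fin (n + 1)) (x : M) :
    (B.Lam x).adjugate i j = (-1) ^ ((j : ℕ) + (i : ℕ)) * B.minor i j x :=
  Matrix.adjugate_fin_succ_eq_det_submatrix _ _ _

theorem adjugate_ne_zero_iff {i j : Fin (n + 1)} {x : M} :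
    (B.Lam x).adjugate i j ≠ 0 ↔ x ∈ B.dom i j := by
  rw [adjugate_Lam, mul_ne_zero_iff]
  simp [dom]

theorem fund_eq_div (i j h : Fin (n + 1)) (x : M) :
    B.fund i j h x = (B.Lam x).adjugate i j / (B.Lam x).adjugate i h := by
  rw [adjugate_Lam, adjugate_Lam, fund, mul_div_mul_comm]
  congr 1
  rw [eq_div_iff (by simp), ← pow_add]
  rw [show (j : ℕ) + h + (h + i) = (j + i) + 2 * h by ring, pow_add, pow_mul]
  simp

theorem adjugate_mul_Lam (i l : Fin (n + 1)) (x : M) :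
    ∑ a, (B.Lam x).adjugate i a * B.eigenvalue a l x = if i = l then (B.Lam x).det else 0 := by
  have := congrFun (congrFun (Matrix.adjugate_mul (B.Lam x)) i) l
  simpa [Matrix.mul_apply, Matrix.one_apply, Lam] using this

theorem fund_self {i h : Fin (n + 1)} {x : M} (hx : x ∈ B.dom i h) : B.fund i h h x = 1 := by
  rw [fund_eq_div, div_self (B.adjugate_ne_zero_iff.2 hx)]

theorem sum_fund_mul (i h l : Fin (n + 1)) (x : M) :
    ∑ a, B.fund i a h x * B.eigenvalue a l x =
      if i = l then (B.Lam x).det / (B.Lam x).adjugate i h else 0 := by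
  simp only [fund_eq_div, div_mul_eq_mul_div, ← Finset.sum_div, adjugate_mul_Lam]
  split_ifs <;> simp

/-- A row vector that annihilates all columns of `Λ` but the `i`-th is determined by its `h`-th
entry. -/
theorem eq_zero_of_sum_mul_eigenvalue {i h : Fin (n + 1)} {x : M} (hx : x ∈ B.dom i h)
    {u : Fin (n + 1) → ℝ} (hu : ∀ l, l ≠ i → ∑ a, u a * B.eigenvalue a l x = 0) (huh : u h = 0) :
    u = 0 := by
  set t := ∑ a, u a * B.eigenvalue a i x with ht
  have h1 : Matrix.vecMul u (B.Lam x) = Pi.single i t := by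
    funext l
    by_cases hl : l = i
    · subst hl; simp [ht, Matrix.vecMul, dotProduct, Lam]
    · simpa [hl, Matrix.vecMul, dotProduct, Lam] using hu l hl
  have h2 : (B.Lam x).det • u = t • (B.Lam x).adjugate i := by
    -- Multiplying by the adjugate shows that `u` is proportional to its `i`-th row, whose `h`-th
    -- entry is nonzero.
    have h3 := congrArg (fun w => Matrix.vecMul w (B.Lam x).adjugate) h1
    simp only [Matrix.vecMul_vecMul, Matrix.mul_adjugate, Matrix.vecMul_smul,
      Matrix.vecMul_one] at h3
    rw [h3]
    funext l
    simp [Matrix.single_vecMul, Matrix.row]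
  have h3 : t = 0 := by
    have := congrFun h2 h
    simp only [Pi.smul_apply, huh, mul_zero, smul_eq_mul] at this
    exact (mul_eq_zero.1 this.symm).resolve_right (B.adjugate_ne_zero_iff.2 hx)
  rw [h3, zero_smul] at h2
  exact (smul_eq_zero.1 h2).resolve_left (B.det_Lam_ne_zero x)

/-- Otherwise the `i`-th row of the adjugate has only its last entry. Since the last row of `Λ`
consists of ones, its product with `Λ` would have equal entries, whereas it is `det Λ` at `i` and 0
elsewhere. -/
theorem exists_mem_dom (hn : 0 < n) (i : Fin (n + 1)) (x : M) :
    ∃ h, h < Fin.last n ∧ x ∈ B.dom i h := by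
  by_contra! H
  have h0 : ∀ a : Fin (n + 1), a ≠ Fin.last n → (B.Lam x).adjugate i a = 0 := by
    intro a ha
    by_contra h
    exact H a (lt_of_le_of_ne (Fin.le_last a) ha) (B.adjugate_ne_zero_iff.1 h)
  have h1 : ∀ l, (B.Lam x).adjugate i (Fin.last n) = if i = l then (B.Lam x).det else 0 := by
    intro l
    rw [← B.adjugate_mul_Lam, Finset.sum_eq_single (Fin.last n) (fun a _ ha => by simp [h0 a ha])
      (by simp), B.eigenvalue_last, mul_one]
  have : Nontrivial (Fin (n + 1)) := Fin.nontrivial_iff_two_le.2 (by omega)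
  obtain ⟨l, hl⟩ := exists_ne i
  have h2 := h1 l
  rw [h1 i] at h2
  simp [hl.symm] at h2
  exact B.det_Lam_ne_zero x h2

/-- The square norm, up to the squared determinant of `Λ`, of the `i`-th row of the inverse of `Λ` without its last
entry. -/
def rowSq (i : Fin (n + 1)) (x : M) : ℝ :=
  ∑ j : Fin n, (B.Lam x).adjugate i j.castSucc ^ 2

theorem rowSq_pos (hn : 0 < n) (i : Fin (n + 1)) (x : M) : 0 < B.rowSq i x := by
  obtain ⟨h, hh, hx⟩ := B.exists_mem_dom hn i x
  refine Finset.sum_pos' (fun _ _ => sq_nonneg _) ⟨h.castPred hh.ne, Finset.mem_univ _, ?_⟩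
  rw [Fin.castSucc_castPred]
  exact sq_pos_of_ne_zero (B.adjugate_ne_zero_iff.2 hx)

/-- The factor that makes `E_i` a conformal Killing vector when the fundamental functions are
locally constant. -/
def scale (i : Fin (n + 1)) (x : M) : ℝ :=
  √√(B.eps i x * (B.Lam x).det * (B.eps i x * (B.Lam x).det) / B.rowSq i x)

theorem scale_arg_pos (hn : 0 < n) (i : Fin (n + 1)) (x : M) :
    0 < B.eps i x * (B.Lam x).det * (B.eps i x * (B.Lam x).det) / B.rowSq i x :=
  div_pos (mul_self_pos.2 (mul_ne_zero (B.eps_ne_zero i x) (B.det_Lam_ne_zero x)))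
    (B.rowSq_pos hn i x)

theorem scale_pos (hn : 0 < n) (i : Fin (n + 1)) (x : M) : 0 < B.scale i x :=
  Real.sqrt_pos.2 (Real.sqrt_pos.2 (B.scale_arg_pos hn i x))

/-- `scale` is defined without reference to `h`, hence globally. On each `dom i h` its square is the
modulus of the coefficient of `E_i ⊗ E_i` in `∑ a, f_i^{ah} K_a`, divided by a quantity that is
locally constant when the fundamental functions are. -/
theorem scale_sq {i h : Fin (n + 1)} {x : M} (hx : x ∈ B.dom i h) :
    B.scale i x ^ 2 = |B.eps i x * ((B.Lam x).det / (B.Lam x).adjugate i h)| /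
      √(∑ j : Fin n, B.fund i j.castSucc h x ^ 2) := by
  have h0 := B.adjugate_ne_zero_iff.2 hx
  have h1 : B.rowSq i x =
      (B.Lam x).adjugate i h * (B.Lam x).adjugate i h * ∑ j : Fin n, B.fund i j.castSucc h x ^ 2 := by
    rw [rowSq, Finset.mul_sum]
    refine Finset.sum_congr rfl fun j _ => ?_
    rw [fund_eq_div]
    field_simp
  rw [scale, Real.sq_sqrt (Real.sqrt_nonneg _), h1, ← div_div, Real.sqrt_div
      (div_nonneg (mul_self_nonneg _) (mul_self_nonneg _)),
    mul_div_mul_comm, Real.sqrt_mul_self_eq_abs, mul_div_assoc]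

/-! ### Differentials of the fundamental functions -/

section Smooth

variable [T2Space M]

theorem contMDiffAt_adjugate_Lam (i j : Fin (n + 1)) (x : M) :
    ContMDiffAt (𝓡 (n + 1)) 𝓘(ℝ, ℝ) ∞ (fun y => (B.Lam y).adjugate i j) x :=
  contMDiffAt_adjugate (fun a k => (B.isSmooth_eigenvalue a k).contMDiffAt) i j

theorem isOpen_dom (i h : Fin (n + 1)) : IsOpen (B.dom i h) := by
  have hc : Continuous fun y => (B.Lam y).adjugate i h := continuous_iff_continuousAt.2 fun x =>
    (B.contMDiffAt_adjugate_Lam i h x).continuousAt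
  have : B.dom i h = {x | (B.Lam x).adjugate i h ≠ 0} := Set.ext fun x =>
    B.adjugate_ne_zero_iff.symm
  rw [this]
  exact isOpen_ne_fun hc continuous_const

theorem contMDiffAt_fund {i h : Fin (n + 1)} (j : Fin (n + 1)) {x : M} (hx : x ∈ B.dom i h) :
    ContMDiffAt (𝓡 (n + 1)) 𝓘(ℝ, ℝ) ∞ (B.fund i j h) x := by
  rw [show B.fund i j h = _ from funext (B.fund_eq_div i j h)]
  exact (B.contMDiffAt_adjugate_Lam i j x).div_of_ne (B.contMDiffAt_adjugate_Lam i h x)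
    (B.adjugate_ne_zero_iff.2 hx)

theorem sum_diff_fund {i h l : Fin (n + 1)} (hl : l ≠ i) {x : M} (hx : x ∈ B.dom i h)
    (v : TangentSpace (𝓡 (n + 1)) x) :
    ∑ a, diff (B.fund i a h) x v * B.eigenvalue a l x =
      -∑ a, B.fund i a h x * diff (B.eigenvalue a l) x v := by
  have hF : ∀ a, MDifferentiableAt (𝓡 (n + 1)) 𝓘(ℝ, ℝ) (B.fund i a h) x := fun a =>
    (B.contMDiffAt_fund a hx).mdiffAt
  have hE : ∀ a, MDifferentiableAt (𝓡 (n + 1)) 𝓘(ℝ, ℝ) (B.eigenvalue a l) x := fun a =>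
    (B.isSmooth_eigenvalue a l).mdiffAt x
  have h1 := diff_sum (s := Finset.univ) (f := fun a y => B.fund i a h y * B.eigenvalue a l y)
    fun a _ => (hF a).mul (hE a)
  have h2 : diff (d := n + 1) (fun y => ∑ a, B.fund i a h y * B.eigenvalue a l y) x = 0 := by
    simp only [B.sum_fund_mul, hl.symm, if_false]
    exact diff_const 0 x
  rw [h2] at h1
  have h3 := congrArg (fun α => α v) h1
  simp only [sum_apply, zero_apply] at h3
  rw [eq_neg_iff_add_eq_zero, ← Finset.sum_add_distrib, h3]
  refine Finset.sum_congr rfl fun a _ => ?_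
  rw [diff_mul (hF a) (hE a)]
  simp only [add_apply, smul_apply, smul_eq_mul]
  ring

/-- Differentiating `∑ a, f_i^{ah} λ_a^l = 0` gives a row whose products with the columns `l ≠ i`
are all `-τ`. Adding `τ` to its last entry, which multiplies the eigenvalue 1 of `G`, makes these
products zero. As `f_i^{hh} = 1`, the `h`-th entry vanishes, and so does the row. -/
theorem diff_fund_apply_eq_zero {i h : Fin (n + 1)} (hh : h < Fin.last n) {x : M}
    (hx : x ∈ B.dom i h) {v : TangentSpace (𝓡 (n + 1)) x} {τ : ℝ}
    (hτ : ∀ l, l ≠ i → ∑ a, B.fund i a h x * diff (B.eigenvalue a l) x v = τ)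
    {j : Fin (n + 1)} (hj : j < Fin.last n) : diff (B.fund i j h) x v = 0 := by
  let u : Fin (n + 1) → ℝ := fun a => diff (B.fund i a h) x v + if a = Fin.last n then τ else 0
  have h1 : diff (B.fund i h h) x v = 0 := by
    have : B.fund i h h =ᶠ[𝓝 x] fun _ => 1 := by
      filter_upwards [(B.isOpen_dom i h).mem_nhds hx] with y hy
      exact B.fund_self hy
    rw [diff_congr this, diff_const]
    rfl
  have hu : u = 0 := by
    refine B.eq_zero_of_sum_mul_eigenvalue hx (fun l hl => ?_) (by simp [u, hh.ne, h1])
    simp [u, add_mul, Finset.sum_add_distrib, B.sum_diff_fund hl hx, hτ l hl, B.eigenvalue_last]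
  have := congrFun hu j
  simpa [u, hj.ne] using this

/-- In the conformal Killing equation the term with `connectionCoeff` is killed by contraction with
`f_i^{ah}`, because neither `k` nor `l` is `i`. -/
theorem diff_fund_apply_of_ne {i k h : Fin (n + 1)} (hk : k ≠ i) (hh : h < Fin.last n) {x : M}
    (hx : x ∈ B.dom i h) {j : Fin (n + 1)} (hj : j < Fin.last n) :
    diff (B.fund i j h) x (B.E k x) = 0 := by
  obtain ⟨g, hg, hgx⟩ := B.exists_dual_functions x
  refine B.diff_fund_apply_eq_zero hh hx
    (τ := ∑ a, B.fund i a h x * diff (B.eigenvalue a k) x (B.E k x)) (fun l hl => ?_) hj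
  by_cases hlk : l = k
  · rw [hlk]
  have h1 : ∀ a, diff (B.eigenvalue a l) x (B.E k x) = diff (B.eigenvalue a k) x (B.E k x) +
      B.connectionCoeff k l (g l) x * (B.eigenvalue a k x - B.eigenvalue a l x) := fun a => by
    have := B.deriv_eigenvalue_sub (Ne.symm hlk) (hg l) (fun m => hgx m l) a
    simp only [deriv] at this
    linarith
  have h2 := B.sum_fund_mul i h k x
  have h3 := B.sum_fund_mul i h l x
  rw [if_neg hk.symm] at h2
  rw [if_neg hl.symm] at h3
  simp only [h1, mul_add, mul_sub, mul_left_comm (B.fund _ _ _ _), Finset.sum_add_distrib,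
    Finset.sum_sub_distrib, ← Finset.mul_sum, h2, h3]
  ring

/-- A conformal Killing vector parallel to `E_i` leaves the fundamental functions invariant. -/
theorem diff_fund_eq_zero_of_isCKV {ρ : M → ℝ} (hρ : IsSmooth (d := n + 1) ρ)
    (hρ0 : ∀ x, ρ x ≠ 0) {i : Fin (n + 1)} (hX : IsCKV G.toSymTensor (fun x => ρ x • B.E i x))
    {h : Fin (n + 1)} (hh : h < Fin.last n) {x : M} (hx : x ∈ B.dom i h) {j : Fin (n + 1)}
    (hj : j < Fin.last n) : diff (d := n + 1) (B.fund i j h) x = 0 := by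
  refine B.covector_ext fun k => ?_
  by_cases hk : k ≠ i
  · rw [B.diff_fund_apply_of_ne hk hh hx hj, zero_apply]
  obtain rfl := not_not.1 hk
  obtain ⟨-, F, hF⟩ := hX
  obtain ⟨g, hg, hgx⟩ := B.exists_dual_functions x
  -- This is the `(l, l)` component of `L_X G = F G`. The derivatives of `ρ` drop out because `E_k(g
  -- l)` vanishes at `x`. The value does not depend on `l`.
  have hΓ : ∀ l, l ≠ k → B.connectionCoeff k l (g l) x = F x / ρ x := by
    intro l hl
    have h1 := hF (g l) (hg l) x
    have hsum : ∀ Y : Fin (n + 1) → ℝ, ∑ m, Y m * (if m = l then 1 else 0) ^ 2 = Y l := by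
      intro Y
      simp [ite_pow]
    have hX : (fun y => diff (g l) y (ρ y • B.E k y)) = fun y => ρ y * B.deriv k (g l) y := by
      funext y; simp [deriv]
    have hXd : ∀ m, diff (fun y => diff (g l) y (ρ y • B.E k y)) x (B.E m x) =
        ρ x * B.deriv m (B.deriv k (g l)) x := by
      intro m
      rw [hX, diff_mul (hρ.mdiffAt x) ((B.isSmooth_deriv k (hg l)).mdiffAt x), hgx]
      simp [hl.symm, deriv]
    rw [lieDeriv, B.metric_quad_eq_sum, map_smul, smul_eq_mul, B.diff_metric_quad (hg l),
      B.metric_form_eq_sum] at h1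
    simp only [hXd, B.diff_E, hgx, hsum, Finset.sum_add_distrib] at h1
    have e1 : ∑ m, 2 * B.eps m x * (if m = l then 1 else 0) * B.deriv k (B.deriv m (g l)) x =
        2 * B.eps l x * B.deriv k (B.deriv l (g l)) x := by simp
    have e2 : ∑ m, B.eps m x * ((if m = l then 1 else 0) *
        (ρ x * B.deriv m (B.deriv k (g l)) x)) =
        B.eps l x * (ρ x * B.deriv l (B.deriv k (g l)) x) := by simp
    rw [e1, e2] at h1
    have := B.eps_ne_zero l x
    have := hρ0 x
    rw [connectionCoeff]
    field_simp
    linarith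
  -- Now `k = i`, so the terms with `λ_a^k` survive the contraction. They are independent of `l`
  -- since `F / ρ` is, and go into `τ`.
  refine B.diff_fund_apply_eq_zero hh hx (τ := ∑ a, B.fund k a h x *
    (diff (B.eigenvalue a k) x (B.E k x) + F x / ρ x * B.eigenvalue a k x)) (fun l hl => ?_) hj
  have h1 : ∀ a, diff (B.eigenvalue a l) x (B.E k x) = (diff (B.eigenvalue a k) x (B.E k x) +
      F x / ρ x * B.eigenvalue a k x) - F x / ρ x * B.eigenvalue a l x := fun a => by
    have := B.deriv_eigenvalue_sub hl.symm (hg l) (fun m => hgx m l) a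
    rw [hΓ l hl] at this
    simp only [deriv] at this
    linarith
  have h3 := B.sum_fund_mul k h l x
  rw [if_neg hl.symm] at h3
  simp only [h1]
  simp only [mul_sub, Finset.sum_sub_distrib, mul_left_comm (B.fund _ _ _ _) (F x / ρ x) (_),
    ← Finset.mul_sum, h3, mul_zero, sub_zero]

theorem isOrthogonalHypersurface_fund {i j h : Fin (n + 1)} (hh : h < Fin.last n)
    (hj : j < Fin.last n) {p : M} (hp : p ∈ B.dom i h) (hd : diff (d := n + 1) (B.fund i j h) p ≠ 0) :
    ∃ V : Set M, IsOpen V ∧ p ∈ V ∧ V ⊆ B.dom i h ∧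
      ∀ c : ℝ, IsOrthogonalHypersurface G.toSymTensor (B.E i) {x ∈ V | B.fund i j h x = c} := by
  obtain ⟨φ, hφ, k, hpφ, hsub, hφk⟩ := exists_chart_coord (B.isOpen_dom i h)
    (fun x hx => (B.contMDiffAt_fund j hx).contMDiffWithinAt) hp hd
  refine ⟨φ.source, φ.open_source, hpφ, hsub, fun c x hx => ⟨φ, hφ, k, hx.1, ?_, fun v hv => ?_⟩⟩
  · ext y
    constructor
    · rintro ⟨⟨-, hy⟩, hys⟩
      exact ⟨hys, by rw [(hφk y hys).1, (hφk x hx.1).1, hy, hx.2]⟩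
    · rintro ⟨hys, hy⟩
      rw [(hφk y hys).1, (hφk x hx.1).1, hx.2] at hy
      exact ⟨⟨hys, hy⟩, hys⟩
  · have h1 : (fun y => φ y k) =ᶠ[𝓝 x] B.fund i j h := by
      filter_upwards [φ.open_source.mem_nhds hx.1] with y hy using (hφk y hy).1
    rw [diff_congr h1] at hv
    refine ⟨B.lowered i x, B.isLowered_lowered i x, ?_⟩
    -- Both covectors vanish on every `E_m` with `m ≠ i`, hence they are proportional.
    have h2 : B.lowered i x (B.E i x) • diff (B.fund i j h) x =
        diff (B.fund i j h) x (B.E i x) • B.lowered i x := by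
      refine B.covector_ext fun m => ?_
      by_cases hm : m = i
      · subst hm
        simp [mul_comm]
      · simp [B.diff_fund_apply_of_ne hm hh (hsub hx.1) hj, B.lowered_apply_of_ne (Ne.symm hm)]
    have h3 : diff (B.fund i j h) x (B.E i x) ≠ 0 := by
      intro h0
      rw [h0, zero_smul] at h2
      exact (hφk x hx.1).2 ((smul_eq_zero.1 h2).resolve_left (B.lowered_apply_self_ne_zero i x))
    have h4 := congrArg (fun α => α v) h2
    simp only [smul_apply, smul_eq_mul, hv, mul_zero] at h4
    exact (mul_eq_zero.1 h4.symm).resolve_left h3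

end Smooth

end CKBasis

end FundamentalFunctions

/-! ### Polarization of the Lie derivative -/

section Tensors

variable {d : ℕ} {M : Type*} [TopologicalSpace M] [ChartedSpace (EuclideanSpace ℝ (Fin d)) M]

theorem IsSmooth.quad (K : SymTensor d M) {f : M → ℝ} (hf : IsSmooth (d := d) f) :
    IsSmooth (d := d) (K.quad f) := K.smooth f f hf hf

variable [IsManifold (𝓡 d) ∞ M]

/-- The Lie derivative `(L_X G)(df, df)` is a quadratic form in `f`. -/
theorem lieDeriv_add_add_lieDeriv_sub (G : SymTensor d M) {X : (x : M) → TangentSpace (𝓡 d) x}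
    (hX : IsSmoothField X) {f g : M → ℝ} (hf : IsSmooth (d := d) f) (hg : IsSmooth (d := d) g)
    (x : M) :
    lieDeriv X G (fun y => f y + g y) x + lieDeriv X G (fun y => f y - g y) x =
      2 * lieDeriv X G f x + 2 * lieDeriv X G g x := by
  have ha : ∀ y, diff (d := d) (fun y => f y + g y) y = diff f y + diff g y := fun y =>
    diff_add (hf.mdiffAt y) (hg.mdiffAt y)
  have hs : ∀ y, diff (d := d) (fun y => f y - g y) y = diff f y - diff g y := fun y =>
    diff_sub (hf.mdiffAt y) (hg.mdiffAt y)
  have hfq := (hf.quad G).mdiffAt x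
  have hgq := (hg.quad G).mdiffAt x
  have hXf := (hf.field_apply hX).mdiffAt x
  have hXg := (hg.field_apply hX).mdiffAt x
  have h1 : diff (d := d) (G.quad fun y => f y + g y) x + diff (G.quad fun y => f y - g y) x =
      (2 : ℝ) • diff (G.quad f) x + (2 : ℝ) • diff (G.quad g) x := by
    have hfg : IsSmooth (d := d) (fun y => f y + g y) := hf.add hg
    have hfg' : IsSmooth (d := d) (fun y => f y - g y) := hf.sub hg
    rw [← diff_add ((hfg.quad G).mdiffAt x) ((hfg'.quad G).mdiffAt x),
      ← diff_const_mul 2 hfq, ← diff_const_mul 2 hgq,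
      ← diff_add (f := fun y => 2 * G.quad f y) (g := fun y => 2 * G.quad g y)
        (mdifferentiableAt_const.mul hfq) (mdifferentiableAt_const.mul hgq)]
    congr 1
    funext y
    simp only [SymTensor.quad, ha, hs, map_add, map_sub, LinearMap.add_apply, LinearMap.sub_apply]
    ring
  have h2 := congrArg (fun α => α (X x)) h1
  simp only [add_apply, smul_apply, smul_eq_mul] at h2
  simp only [lieDeriv, ha, hs, add_apply, sub_apply]
  rw [diff_add hXf hXg, diff_sub hXf hXg]
  simp only [map_add, map_sub, LinearMap.add_apply, LinearMap.sub_apply]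
  linear_combination h2

end Tensors

/-! ### Locally constant fundamental functions yield a conformal Killing vector -/

section Symmetry

variable {n : ℕ} {M : Type*} [TopologicalSpace M]
  [ChartedSpace (EuclideanSpace ℝ (Fin (n + 1))) M] [IsManifold (𝓡 (n + 1)) ∞ M]
  {G : Metric (n + 1) M} (B : CKBasis G)

namespace CKBasis

variable [T2Space M]

/-- For `j < h`, where `f_i^{jh}` is nonzero it is the inverse of `f_i^{hj}`, which has zero
differential. Where it vanishes, its square has zero differential. So the square is locally
constant, and `f_i^{jh}` vanishes near each of its zeros. -/
theorem diff_fund_eq_zero_of_lt {i : Fin (n + 1)}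
    (H : ∀ h j, h < j → j < Fin.last n → ∀ p ∈ B.dom i h, diff (d := n + 1) (B.fund i j h) p = 0)
    {h j : Fin (n + 1)} (hh : h < Fin.last n) (hj : j < Fin.last n) {p : M} (hp : p ∈ B.dom i h) :
    diff (d := n + 1) (B.fund i j h) p = 0 := by
  rcases lt_trichotomy h j with hlt | rfl | hlt
  · exact H h j hlt hj p hp
  · have : B.fund i h h =ᶠ[𝓝 p] fun _ => 1 := by
      filter_upwards [(B.isOpen_dom i h).mem_nhds hp] with y hy
      exact B.fund_self hy
    rw [diff_congr this, diff_const]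
  have hm : ∀ y ∈ B.dom i h, MDifferentiableAt (𝓡 (n + 1)) 𝓘(ℝ, ℝ) (B.fund i j h) y :=
    fun y hy => (B.contMDiffAt_fund j hy).mdiffAt
  have hinv : ∀ y ∈ B.dom i h, y ∈ B.dom i j → B.fund i j h y * B.fund i h j y = 1 := by
    intro y hy hy'
    rw [fund_eq_div, fund_eq_div]
    have := B.adjugate_ne_zero_iff.2 hy
    have := B.adjugate_ne_zero_iff.2 hy'
    field_simp
  have h0 : ∀ y ∈ B.dom i h, y ∈ B.dom i j → diff (d := n + 1) (B.fund i j h) y = 0 := by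
    intro y hy hy'
    have h1 : (fun y => B.fund i j h y * B.fund i h j y) =ᶠ[𝓝 y] fun _ => 1 := by
      filter_upwards [(B.isOpen_dom i h).mem_nhds hy, (B.isOpen_dom i j).mem_nhds hy'] with z hz hz'
      exact hinv z hz hz'
    have h2 := diff_congr (d := n + 1) h1
    rw [diff_mul (hm y hy) (B.contMDiffAt_fund h hy').mdiffAt, diff_const, H j h hlt hh y hy',
      smul_zero, zero_add] at h2
    exact (smul_eq_zero.1 h2).resolve_left (right_ne_zero_of_mul_eq_one (hinv y hy hy'))
  by_cases hpj : p ∈ B.dom i j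
  · exact h0 p hp hpj
  have hz : ∀ y, y ∉ B.dom i j → B.fund i j h y = 0 := fun y hy => by
    have : B.minor i j y = 0 := not_not.1 hy
    simp [fund, this]
  have hsq : ∀ y ∈ B.dom i h, diff (d := n + 1) (fun z => B.fund i j h z * B.fund i j h z) y = 0 := by
    intro y hy
    rw [diff_mul (hm y hy) (hm y hy)]
    by_cases hyj : y ∈ B.dom i j
    · simp [h0 y hy hyj]
    · simp [hz y hyj]
  have h1 : B.fund i j h =ᶠ[𝓝 p] fun _ => 0 := by
    filter_upwards [eventually_eq_of_diff_eq_zero (B.isOpen_dom i h) hp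
      (fun y hy => (hm y hy).mul (hm y hy)) hsq] with y hy
    rw [Pi.mul_apply, Pi.mul_apply, hz p hpj, mul_zero] at hy
    exact mul_self_eq_zero.1 hy
  rw [diff_congr h1, diff_const]

/-- Cancels the factor `X` in `X ⊙ L_X G = c ⊙ G`. The dual covectors other than the `i`-th
annihilate `X` but not their own metric square, so `c` vanishes on them and is a multiple of `X`.
Covectors annihilating `X` are reached from others by the parallelogram identity. -/
theorem lieDeriv_eq_of_mul_eq {i : Fin (n + 1)} {X : (x : M) → TangentSpace (𝓡 (n + 1)) x}
    (hX : IsSmoothField X) {x : M} {r : ℝ} (hr : r ≠ 0) (hXx : X x = r • B.E i x)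
    (c : (TangentSpace (𝓡 (n + 1)) x →L[ℝ] ℝ) →ₗ[ℝ] ℝ)
    (hc : ∀ f : M → ℝ, IsSmooth (d := n + 1) f →
      diff f x (X x) * lieDeriv X G.toSymTensor f x = c (diff f x) * G.quad f x) :
    ∃ F : ℝ, ∀ f : M → ℝ, IsSmooth (d := n + 1) f →
      lieDeriv X G.toSymTensor f x = F * G.quad f x := by
  have hck : ∀ k, k ≠ i → c (B.dual k x) = 0 := by
    intro k hk
    obtain ⟨f, hf, hfx⟩ := exists_isSmooth_diff_eq (d := n + 1) x (B.dual k x)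
    have h1 := hc f hf
    rw [SymTensor.quad, hfx, hXx, map_smul, B.dual_apply, if_neg hk.symm, smul_zero, zero_mul] at h1
    exact (mul_eq_zero.1 h1.symm).resolve_right (B.eps_ne_zero k x)
  have hcα : ∀ α, c α = c (B.dual i x) / r * α (X x) := by
    intro α
    conv_lhs => rw [B.covector_eq_sum x α]
    rw [map_sum, Finset.sum_eq_single i (fun k _ hk => by simp [hck k hk]) (by simp), hXx]
    simp only [map_smul, smul_eq_mul]
    field_simp
  have hF : ∀ f : M → ℝ, IsSmooth (d := n + 1) f → diff f x (X x) ≠ 0 →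
      lieDeriv X G.toSymTensor f x = c (B.dual i x) / r * G.quad f x := by
    intro f hf h0
    refine mul_left_cancel₀ h0 ?_
    rw [hc f hf, hcα]
    ring
  refine ⟨c (B.dual i x) / r, fun f hf => ?_⟩
  by_cases h0 : diff f x (X x) = 0
  swap
  · exact hF f hf h0
  obtain ⟨g, hg, hgx⟩ := exists_isSmooth_diff_eq (d := n + 1) x (B.dual i x)
  have hgX : diff g x (X x) = r := by simp [hgx, hXx, B.dual_apply]
  have ha : diff (d := n + 1) (fun y => f y + g y) x = diff f x + diff g x :=
    diff_add (hf.mdiffAt x) (hg.mdiffAt x)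
  have hs : diff (d := n + 1) (fun y => f y - g y) x = diff f x - diff g x :=
    diff_sub (hf.mdiffAt x) (hg.mdiffAt x)
  have e1 := hF (fun y => f y + g y) (hf.add hg) (by simp [ha, h0, hgX, hr])
  have e2 := hF (fun y => f y - g y) (hf.sub hg) (by simp [hs, h0, hgX, hr])
  have e3 := hF g hg (by simp [hgX, hr])
  have e4 := lieDeriv_add_add_lieDeriv_sub G.toSymTensor hX hf hg x
  simp only [SymTensor.quad, ha, hs, map_add, map_sub, LinearMap.add_apply,
    LinearMap.sub_apply] at e1 e2 e3 ⊢
  linear_combination (e1 + e2 - e4) / 2 - e3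

/-- A vector field whose square is, up to a multiple of the metric, a constant linear combination of
the conformal Killing tensors is a conformal Killing vector. -/
theorem exists_lieDeriv_eq {i : Fin (n + 1)} {X : (x : M) → TangentSpace (𝓡 (n + 1)) x}
    (hX : IsSmoothField X) {x : M} {r : ℝ} (hr : r ≠ 0) (hXx : X x = r • B.E i x)
    (c : Fin (n + 1) → ℝ) {φ : M → ℝ} (hφ : MDifferentiableAt (𝓡 (n + 1)) 𝓘(ℝ, ℝ) φ x) {κ : ℝ}
    (hκ : κ ≠ 0) (hK : ∀ᶠ y in 𝓝 x, ∀ α β : TangentSpace (𝓡 (n + 1)) y →L[ℝ] ℝ,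
      ∑ a, c a * (B.K a).form y α β = κ * (α (X y) * β (X y)) - φ y * G.form y α β) :
    ∃ F : ℝ, ∀ f : M → ℝ, IsSmooth (d := n + 1) f →
      lieDeriv X G.toSymTensor f x = F * G.quad f x := by
  choose C hC using B.isCKT
  -- With `T = κ X ⊗ X - φ G`, the bracket `[T, G]` on `(df, df, df)` is `2 κ (X f) (L_X G)(df, df)
  -- + 2 G(df, dφ) G(df, df)`. Comparing with `2 (∑ a, c a • C a) ⊙ G` gives this covector
  -- coefficient.
  let L : (TangentSpace (𝓡 (n + 1)) x →L[ℝ] ℝ) →ₗ[ℝ] ℝ :=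
    { toFun := fun α => κ⁻¹ * (α (∑ a, c a • C a x) - G.form x (diff φ x) α)
      map_add' := fun α β => by simp only [add_apply, map_add]; ring
      map_smul' := fun t α => by simp only [smul_apply, map_smul, smul_eq_mul, RingHom.id_apply]; ring }
  refine B.lieDeriv_eq_of_mul_eq hX hr hXx L fun f hf => ?_
  have hq : ∀ a, MDifferentiableAt (𝓡 (n + 1)) 𝓘(ℝ, ℝ) ((B.K a).quad f) x := fun a =>
    (hf.quad (B.K a)).mdiffAt x
  have hGq : MDifferentiableAt (𝓡 (n + 1)) 𝓘(ℝ, ℝ) (G.quad f) x :=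
    (hf.quad G.toSymTensor).mdiffAt x
  have hXf := (hf.field_apply hX).mdiffAt x
  have hXf2 : MDifferentiableAt (𝓡 (n + 1)) 𝓘(ℝ, ℝ)
      (fun y => diff f y (X y) * diff f y (X y)) x := hXf.mul hXf
  have hκX : MDifferentiableAt (𝓡 (n + 1)) 𝓘(ℝ, ℝ)
      (fun y => κ * (diff f y (X y) * diff f y (X y))) x := mdifferentiableAt_const.mul hXf2
  have hφG : MDifferentiableAt (𝓡 (n + 1)) 𝓘(ℝ, ℝ) (fun y => φ y * G.quad f y) x := hφ.mul hGq
  have h1 : ∑ a, c a • diff ((B.K a).quad f) x =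
      κ • ((2 * diff f x (X x)) • diff (d := n + 1) (fun y => diff f y (X y)) x) -
        (φ x • diff (G.quad f) x + G.quad f x • diff φ x) := by
    have e1 : (fun y => ∑ a, c a * (B.K a).quad f y) =ᶠ[𝓝 x]
        fun y => κ * (diff f y (X y) * diff f y (X y)) - φ y * G.quad f y := by
      filter_upwards [hK] with y hy
      exact hy _ _
    have e2 := diff_congr (d := n + 1) e1
    rw [diff_sum (f := fun a y => c a * (B.K a).quad f y)
        fun a _ => mdifferentiableAt_const.mul (hq a),
      diff_sub hκX hφG, diff_const_mul κ hXf2, diff_mul hXf hXf, diff_mul hφ hGq] at e2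
    rw [two_mul, add_smul, ← e2]
    exact Finset.sum_congr rfl fun a _ => (diff_const_mul (c a) (hq a)).symm
  have h2 := hK.self_of_nhds (diff f x) (diff (G.quad f) x)
  have h3 : ∑ a, c a * schouten (B.K a) G.toSymTensor f x =
      2 * (diff f x (∑ a, c a • C a x) * G.quad f x) := by
    simp only [hC _ f hf x, symProd, map_sum, map_smul, smul_eq_mul, Finset.sum_mul,
      Finset.mul_sum]
    exact Finset.sum_congr rfl fun a _ => by ring
  have h4 : ∑ a, c a * schouten (B.K a) G.toSymTensor f x =
      2 * (∑ a, c a * (B.K a).form x (diff f x) (diff (G.quad f) x) -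
        G.form x (diff f x) (∑ a, c a • diff ((B.K a).quad f) x)) := by
    simp only [schouten, map_sum, map_smul, smul_eq_mul, ← Finset.sum_sub_distrib, Finset.mul_sum]
    exact Finset.sum_congr rfl fun a _ => by ring
  rw [h3, h1, h2] at h4
  simp only [map_sub, map_add, map_smul, smul_eq_mul] at h4
  have h5 := G.symm x (diff f x) (diff φ x)
  change _ = κ⁻¹ * (diff f x (∑ a, c a • C a x) - G.form x (diff φ x) (diff f x)) * G.quad f x
  rw [← h5]
  refine mul_left_cancel₀ hκ ?_
  rw [lieDeriv, mul_assoc κ⁻¹, mul_inv_cancel_left₀ hκ]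
  linear_combination -h4 / 2

theorem isSmooth_rowSq (i : Fin (n + 1)) : IsSmooth (d := n + 1) (B.rowSq i) := fun x => by
  have : B.rowSq i = fun y => ∑ j : Fin n,
      (B.Lam y).adjugate i j.castSucc * (B.Lam y).adjugate i j.castSucc := by
    funext y
    simp only [rowSq, pow_two]
  rw [this]
  exact ContMDiffAt.sum fun j _ =>
    (B.contMDiffAt_adjugate_Lam i j.castSucc x).mul (B.contMDiffAt_adjugate_Lam i j.castSucc x)

theorem isSmooth_scale (hn : 0 < n) (i : Fin (n + 1)) : IsSmooth (d := n + 1) (B.scale i) := by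
  intro x
  have h1 : ContMDiffAt (𝓡 (n + 1)) 𝓘(ℝ, ℝ) ∞ (fun y => B.eps i y * (B.Lam y).det) x :=
    (B.isSmooth_eps i x).mul (contMDiffAt_det fun a k => (B.isSmooth_eigenvalue a k).contMDiffAt)
  have hpos := B.scale_arg_pos hn i x
  have h2 := (h1.mul h1).div_of_ne (B.isSmooth_rowSq i x) (B.rowSq_pos hn i x).ne'
  have h3 := ((Real.contDiffAt_sqrt hpos.ne' (n := ∞)).contMDiffAt).comp x h2
  exact ((Real.contDiffAt_sqrt (Real.sqrt_pos.2 hpos).ne' (n := ∞)).contMDiffAt).comp x h3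

/-- Near each point the square of the globally rescaled `E_i` is, up to a nonzero constant and a
multiple of `G`, a combination of the `K a` with constant coefficients `f_i^{ah}`. -/
theorem isConformalSymmetry_of_diff_fund_eq_zero (hn : 0 < n) {i : Fin (n + 1)}
    (H : ∀ h j, h < Fin.last n → j < Fin.last n → ∀ p ∈ B.dom i h,
      diff (d := n + 1) (B.fund i j h) p = 0) : B.IsConformalSymmetry i := by
  have hX : IsSmoothField (fun x => B.scale i x • B.E i x) :=
    ContMDiff.smul_section (B.isSmooth_scale hn i) (B.smooth_E i)
  refine ⟨B.scale i, B.isSmooth_scale hn i, fun x => (B.scale_pos hn i x).ne', hX, ?_⟩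
  suffices hF : ∀ x, ∃ F : ℝ, ∀ f : M → ℝ, IsSmooth (d := n + 1) f →
      lieDeriv (fun x => B.scale i x • B.E i x) G.toSymTensor f x = F * G.quad f x by
    choose F hF using hF
    exact ⟨F, fun f hf x => hF x f hf⟩
  intro x
  obtain ⟨h, hh, hx⟩ := B.exists_mem_dom hn i x
  let s : ℝ := √(∑ j : Fin n, B.fund i j.castSucc h x ^ 2)
  have hs : 0 < s := by
    refine Real.sqrt_pos.2 (Finset.sum_pos' (fun _ _ => sq_nonneg _)
      ⟨h.castPred hh.ne, Finset.mem_univ _, ?_⟩)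
    rw [Fin.castSucc_castPred, B.fund_self hx]
    norm_num
  let r : M → ℝ := fun y => B.eps i y * ((B.Lam y).det / (B.Lam y).adjugate i h)
  have hr0 : r x ≠ 0 := mul_ne_zero (B.eps_ne_zero i x)
    (div_ne_zero (B.det_Lam_ne_zero x) (B.adjugate_ne_zero_iff.2 hx))
  have hrc : ContinuousAt r x := by
    refine (B.isSmooth_eps i).continuous.continuousAt.mul (ContMDiffAt.continuousAt
      (I := 𝓡 (n + 1)) (I' := 𝓘(ℝ, ℝ)) (n := ∞) ?_)
    exact (contMDiffAt_det fun a k => (B.isSmooth_eigenvalue a k).contMDiffAt).div_of_ne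
      (B.contMDiffAt_adjugate_Lam i h x) (B.adjugate_ne_zero_iff.2 hx)
  -- `scale` only sees the modulus of `r`; the sign is locally constant and becomes part of `κ`.
  have hsign : ∀ᶠ y in 𝓝 x, r y = SignType.sign (r x) * |r y| := by
    rcases lt_or_gt_of_ne hr0 with h0 | h0
    · filter_upwards [hrc.eventually_lt_const h0] with y hy
      simp [sign_neg h0, abs_of_neg hy]
    · filter_upwards [hrc.eventually_const_lt h0] with y hy
      simp [sign_pos h0, abs_of_pos hy]
  have hsr : ((SignType.sign (r x) : SignType) : ℝ) ≠ 0 := by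
    rcases lt_or_gt_of_ne hr0 with h0 | h0
    · simp [sign_neg h0]
    · simp [sign_pos h0]
  have hconst : ∀ᶠ y in 𝓝 x, ∀ j : Fin n, B.fund i j.castSucc h y = B.fund i j.castSucc h x :=
    eventually_all.2 fun j => eventually_eq_of_diff_eq_zero (B.isOpen_dom i h) hx
      (fun y hy => (B.contMDiffAt_fund _ hy).mdiffAt) (H h _ hh (Fin.castSucc_lt_last j))
  -- The coefficient of `G` itself, the fundamental function with last index, need not be constant.
  -- It is moved to the right as `φ`, and the last constant is 0.
  refine B.exists_lieDeriv_eq hX (B.scale_pos hn i x).ne' rfl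
    (fun a => if a = Fin.last n then 0 else B.fund i a h x)
    (B.contMDiffAt_fund (Fin.last n) hx).mdiffAt
    (κ := SignType.sign (r x) * s) (mul_ne_zero hsr hs.ne') ?_
  filter_upwards [hsign, hconst, (B.isOpen_dom i h).mem_nhds hx] with y hy1 hy2 hy α β
  have hsc : SignType.sign (r x) * s * B.scale i y ^ 2 = r y := by
    rw [B.scale_sq hy]
    simp only [hy2]
    rw [hy1, mul_assoc, mul_div_cancel₀ _ hs.ne']
  have h1 : ∑ a, (if a = Fin.last n then 0 else B.fund i a h x) * (B.K a).form y α β =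
      ∑ a, B.fund i a h y * (B.K a).form y α β - B.fund i (Fin.last n) h y * G.form y α β := by
    rw [Fin.sum_univ_castSucc, Fin.sum_univ_castSucc, B.K_last]
    simp [(Fin.castSucc_lt_last _).ne, hy2]
  have h2 : ∑ a, B.fund i a h y * (B.K a).form y α β = r y * (α (B.E i y) * β (B.E i y)) := by
    simp only [B.form_eq_sum, Finset.mul_sum]
    rw [Finset.sum_comm]
    have h3 : ∀ k, ∑ a, B.fund i a h y * (B.eigenvalue a k y * B.eps k y *
        (α (B.E k y) * β (B.E k y))) = (if i = k then (B.Lam y).det / (B.Lam y).adjugate i h else 0) *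
          (B.eps k y * (α (B.E k y) * β (B.E k y))) := by
      intro k
      rw [← B.sum_fund_mul, Finset.sum_mul]
      exact Finset.sum_congr rfl fun a _ => by ring
    simp only [h3, ite_mul, zero_mul, Finset.sum_ite_eq, Finset.mem_univ, if_true, r]
    ring
  rw [h1, h2, ← hsc]
  simp only [map_smul, smul_eq_mul]
  ring

end CKBasis

end Symmetry

end CKSpace

end

theorem theorem5p9 {n : ℕ} (hn : 2 < n + 1) {M : Type*} [TopologicalSpace M] [T2Space M]
    [ChartedSpace (EuclideanSpace ℝ (Fin (n + 1))) M] [IsManifold (𝓡 (n + 1)) ∞ M]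
    (G : CKSpace.Metric (n + 1) M) (B : CKSpace.CKBasis G) (i : Fin (n + 1)) :
    (B.IsConformalSymmetry i ∨ B.FundDefinesHypersurfaces i) ∧
      ¬ (B.IsConformalSymmetry i ∧ B.FundDefinesHypersurfaces i) := by
  constructor
  · refine or_iff_not_imp_right.2 fun hII => ?_
    refine B.isConformalSymmetry_of_diff_fund_eq_zero (by omega) fun h j hh hj p hp =>
      B.diff_fund_eq_zero_of_lt (fun h j hhj hj p hp => ?_) hh hj hp
    by_contra hd
    exact hII ⟨h, j, hhj, hj, ⟨p, hp, hd⟩, fun q hq hqd =>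
      B.isOrthogonalHypersurface_fund (hhj.trans hj) hj hq hqd⟩
  · rintro ⟨⟨ρ, hρ, hρ0, hX⟩, h, j, hhj, hj, ⟨p, hp, hd⟩, -⟩
    exact hd (B.diff_fund_eq_zero_of_isCKV hρ hρ0 hX (hhj.trans hj) hp hj)
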